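/- For a graph $G$, a hypergraph $H$ is a Berge-$G$ if $V(G)\subseteq V(H)$ and there is a bijection $\phi:E(G)\to E(H)$ with $e\subseteq\phi(e)$ for every $e\in E(G)$; let $\mathcal{B}(G)$ be the family of all Berge-$G$ hypergraphs. For a family $\mathcal{F}$ of hypergraphs, let $R_r(\mathcal{F};k)$ be the least $n$ such that every colouring of the edges of the complete $r$-uniform hypergraph on $n$ vertices with $k$ colours contains a monochromatic subgraph isomorphic to a member of $\mathcal{F}$. Let $K_{a,b}$ be the complete bipartite graph with parts of sizes $a$ and $b$. Let $b\ge 2$, $a>(b-1)!$ and $2\le r<2(a+b)-1$ be fixed integers. Then, as $k\to\infty$, \[ R_r(\mathcal{B}(K_{a,b});k)=\Omega\left(k^{\frac{b}{(r-2)b+1}}\right). \] If moreover $b=2$ or $a+b\le r$, then \[ R_r(\mathcal{B}(K_{a,b});k)=\Theta\left(k^{\frac{b}{(r-2)b+1}}\right). \] The implied constants depend only on $a$, $b$ and $r$. -/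

import Mathlib

open Filter Asymptotics
open scoped Nat

namespace Hypergraph

/-- `F` is contained in `H` as a subgraph, up to renaming the vertices of `F`: there is a map,
injective on the vertices of `F`, that sends vertices of `F` to vertices of `H` and edges of `F` to
edges of `H`. -/
def IsContainedIn {α β : Type*} (F : Hypergraph α) (H : Hypergraph β) : Prop :=
  ∃ f : α → β, Set.InjOn f F.vertexSet ∧
    (F.image f).vertexSet ⊆ H.vertexSet ∧ (F.image f).edgeSet ⊆ H.edgeSet

/-- The complete `r`-uniform hypergraph on `n` vertices. -/
def completeUniform (n r : ℕ) : Hypergraph (Fin n) where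
  vertexSet := Set.univ
  edgeSet := {e | e.ncard = r}
  subset_vertexSet_of_mem_edgeSet' := fun _ _ => Set.subset_univ _

/-- The colour class of the colour `i` in a colouring `c` of the edges of `H`: all vertices of `H`,
and the edges of colour `i`. -/
def colorClass {α κ : Type*} (H : Hypergraph α) (c : H.edgeSet → κ) (i : κ) : Hypergraph α where
  vertexSet := H.vertexSet
  edgeSet := {e | ∃ he : e ∈ H.edgeSet, c ⟨e, he⟩ = i}
  subset_vertexSet_of_mem_edgeSet' := fun _ he =>
    H.subset_vertexSet_of_mem_edgeSet' he.choose

/-- A family of hypergraphs, given by its members on every vertex type. -/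
abbrev Family : Type 1 := (α : Type) → Set (Hypergraph α)

/-- Every colouring of the edges of the complete `r`-uniform hypergraph on `n` vertices with `k`
colours has a monochromatic subgraph that is a member of `𝓕`. -/
def IsRamsey (r : ℕ) (𝓕 : Family) (k n : ℕ) : Prop :=
  ∀ c : (completeUniform n r).edgeSet → Fin k,
    ∃ (i : Fin k) (α : Type) (F : Hypergraph α),
      F ∈ 𝓕 α ∧ F.IsContainedIn ((completeUniform n r).colorClass c i)

/-- The `k`-colour Ramsey number `R_r(𝓕; k)`: the least `n` such that every `k`-colouring of the
edges of the complete `r`-uniform hypergraph on `n` vertices has a monochromatic member of `𝓕`. -/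
noncomputable def ramseyNumber (r : ℕ) (𝓕 : Family) (k : ℕ) : ℕ :=
  sInf {n | IsRamsey r 𝓕 k n}

/-- `H` is a Berge-`G`: the vertices of `G` are (identified, through an injection `f`, with)
vertices of `H`, and there is a bijection `g` from the edges of `G` to the edges of `H` such that
every edge `e` of `G` is contained in `g e`. -/
def IsBerge {W α : Type*} (G : SimpleGraph W) (H : Hypergraph α) : Prop :=
  ∃ f : W → α, Function.Injective f ∧ (∀ w, f w ∈ H.vertexSet) ∧
    ∃ g : G.edgeSet ≃ H.edgeSet,
      ∀ e : G.edgeSet, ∀ w ∈ (e : Sym2 W), f w ∈ (g e : Set α)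

/-- The family `𝓑(G)` of all hypergraphs that are a Berge-`G`. -/
def bergeFamily {W : Type*} (G : SimpleGraph W) : Family := fun _ => {H | IsBerge G H}

/-- `R_r(𝓑(K_{a,b}); k)`. -/
noncomputable def bergeBicliqueRamsey (r a b k : ℕ) : ℕ :=
  ramseyNumber r (bergeFamily (completeBipartiteGraph (Fin a) (Fin b))) k

end Hypergraph

/-! Lower bound. Put `D = 2 ^ b`. Colouring pairs by norms from a finite field gives, on `D ^ s`
points, `2 ^ (s + 2)` colours and no monochromatic `K_{a,b}`: with `t = b - 1`, the common
neighbours of `t + 1` vertices in one colour solve a multilinear system, which has at most `t!`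
solutions (`card_le_factorial_of_prod_add_eq`). This is a dimension count: the functions on the
solution set are filtered by powers of one subspace, and the successive dimensions grow by at most
Eulerian numbers, whose sum is at most `t!`.

To colour an `r`-subset `e` of `{0, …, D ^ L - 1}`, take the largest `s ≤ L` such that `e` meets
each block of length `D ^ s` at most once. The colour records `s`; a colour of the set of block
indices, chosen so that intersecting index sets of equal colour coincide; the residues mod `D ^ s`
of the elements relative to two base elements, the first of each half of `e`; and the norm colour of
the two base residues. By maximality of `s` two block indices are close, so the index sets cost only
`O(D ^ ((L - s) * (r - 2)))` colours; the residues cost `D ^ (s * (r - 2))`. The sum over `s` is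
geometric, with total `O((2 * D ^ (r - 2)) ^ L)`, which is the claimed exponent. Within a colour,
the edges of a Berge copy share one index set, so each is determined by its two base residues: they
form a blow-up of a bipartite graph. As `r < 2 * (a + b) - 1`, the halves of `e` have fewer than `a
+ b` elements, so the clusters cannot hold all core vertices, and the copy projects to a
monochromatic `K_{a,b}`.

Upper bound. In a family without Berge `K_{a,b}`, choose a maximal system of distinct representing
pairs. These pairs form a `K_{a,b}`-free graph, and every set left over is an `r`-clique in it. If
each pair lies in at most `M` such cliques, Kővári–Sós–Turán bounds the family by a multiple of `n ^
(2 - 1 / b)`, and pigeonhole over the colours finishes. For `b = 2` take `M = 2 ^ a`; for `a + b ≤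
r` there are no such cliques. -/

/-! ### Inequalities in an idempotent semiring, meant for subspaces of an algebra -/

section IdemSemiring

variable {R ι : Type*} [IdemCommSemiring R]

lemma idem_sum_le {s : Finset ι} {f : ι → R} {b : R} (h : ∀ i ∈ s, f i ≤ b) :
    ∑ i ∈ s, f i ≤ b := by
  classical
  induction s using Finset.induction_on with
  | empty => simp
  | insert i s hi ih =>
    rw [Finset.sum_insert hi]
    exact add_le (h i (Finset.mem_insert_self _ _))
      (ih fun j hj => h j (Finset.mem_insert_of_mem hj))

lemma le_idem_sum {s : Finset ι} (f : ι → R) {i : ι} (hi : i ∈ s) : f i ≤ ∑ j ∈ s, f j :=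
  Finset.single_le_sum (fun _ _ => zero_le) hi

/-- The model is binary forms: among `c + 1` pairwise independent linear forms, the products of all
but one span degree `c`. The induction multiplies by `P = x i + x k` with `k` the new index. -/
lemma pow_le_sum_prod_erase [DecidableEq ι] (P : R) (x : ι → R) (T : Finset ι) :
    ∀ c, T.card = c + 1 → (∀ i ∈ T, ∀ k ∈ T, i ≠ k → P = x i + x k) →
      P ^ c ≤ ∑ i ∈ T, ∏ k ∈ T.erase i, x k := by
  induction T using Finset.induction_on with
  | empty => intro c hc; simp at hc
  | insert k T hk ih =>
    intro c hc hP
    rw [Finset.card_insert_of_notMem hk] at hc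
    obtain _ | c := c
    · have hT : T = ∅ := by simpa using hc
      subst hT
      simp
    · have h := ih c (by omega) fun i hi j hj hij =>
        hP i (Finset.mem_insert_of_mem hi) j (Finset.mem_insert_of_mem hj) hij
      calc P ^ (c + 1) = P * P ^ c := pow_succ' _ _
        _ ≤ P * ∑ i ∈ T, ∏ k ∈ T.erase i, x k := by gcongr
        _ = ∑ i ∈ T, P * ∏ k ∈ T.erase i, x k := Finset.mul_sum _ _ _
        _ ≤ _ := by
          refine idem_sum_le fun i hi => ?_
          have hik : i ≠ k := by rintro rfl; exact hk hi
          rw [hP i (Finset.mem_insert_of_mem hi) k (Finset.mem_insert_self _ _) hik, add_mul,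
            Finset.mul_prod_erase _ _ hi]
          refine add_le ?_ ?_
          · refine le_trans (le_of_eq ?_)
              (le_idem_sum (s := insert k T) _ (Finset.mem_insert_self k T))
            rw [Finset.erase_insert hk]
          · refine le_trans (le_of_eq ?_)
              (le_idem_sum (s := insert k T) _ (Finset.mem_insert_of_mem hi))
            rw [Finset.erase_insert_of_ne hik.symm, Finset.prod_insert]
            simp [hk]

lemma add_pow_succ_le (x y : R) (c : ℕ) : (x + y) ^ (c + 1) ≤ x * (x + y) ^ c + y ^ (c + 1) := by
  induction c with
  | zero => simp
  | succ c ih =>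
    calc (x + y) ^ (c + 1 + 1) = (x + y) * (x + y) ^ (c + 1) := pow_succ' _ _
      _ ≤ (x + y) * (x * (x + y) ^ c + y ^ (c + 1)) := by gcongr
      _ = x * (x + y) ^ (c + 1) + (x * y ^ (c + 1) + y ^ (c + 1 + 1)) := by ring
      _ ≤ _ := by
        refine add_le le_self_add (add_le ?_ le_add_self)
        refine le_trans ?_ le_self_add
        gcongr
        exact le_add_self

/-- Adds one coordinate, with forms `x i`, to the products `f i` of the others; anything containing
some `f i * x i` is absorbed. Expand `P ^ (c + 1)` over `T` and `M ^ (c + 1)` by `hM`. A term `f j`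
with `j ∈ T` meets its `x j`. For `j ∉ T`, trade `P ^ (c + 1)` for `x k₀ ^ (c + 1)` and apply `hV`;
a remaining `f j * f k` is absorbed because `P = x j + x k`. The numbers of `W`- and `V`-terms are
the coefficients of the Eulerian recursion. -/
lemma mul_pow_succ_le_add_sum [DecidableEq ι] (I T : Finset ι) (hT : T ⊆ I) (c : ℕ)
    (hTc : T.card = c + 2)
    (x f W V : ι → R) (P M N : R) (hP : ∀ i ∈ I, ∀ k ∈ I, i ≠ k → P = x i + x k)
    (hM : ∀ i ∈ I, M ^ (c + 1) ≤ W i + ∑ k ∈ I.erase i, f k * M ^ c)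
    (hV : ∀ i ∈ I, M ^ c ≤ V i + ∑ k ∈ I.erase i, f k * N)
    (hN : ∀ k ∈ I, f k * N ≤ M ^ c) (k₀ : ι) (hk₀ : k₀ ∈ T) :
    (M * P) ^ (c + 1) ≤ (∑ i ∈ T, (∏ k ∈ T.erase i, x k) * W i +
      ∑ i ∈ I \ T, (f i * x k₀ ^ (c + 1)) * V i) + ∑ i ∈ I, (f i * x i) * (M * P) ^ c := by
  set A := ∑ i ∈ T, (∏ k ∈ T.erase i, x k) * W i with hA
  set B := ∑ i ∈ I \ T, (f i * x k₀ ^ (c + 1)) * V i with hB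
  set C := ∑ i ∈ I, (f i * x i) * (M * P) ^ c with hC
  have hAle : A ≤ A + B + C := le_self_add.trans le_self_add
  have hBle : B ≤ A + B + C := le_add_self.trans le_self_add
  have hCle : C ≤ A + B + C := le_add_self
  have hpow := pow_le_sum_prod_erase P x T (c + 1) (by omega)
    fun i hi k hk => hP i (hT hi) k (hT hk)
  have hxP : ∀ i ∈ I, x i ≤ P := by
    intro i hi
    obtain ⟨k, hk, hki⟩ := Finset.exists_mem_ne (by omega : 1 < T.card) i
    rw [hP i hi k (hT hk) hki.symm]
    exact le_self_add
  have key : ∀ i ∈ I, (f i * x i) * (M ^ c * P ^ c) ≤ A + B + C := by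
    intro i hi
    refine le_trans ?_ hCle
    rw [← mul_pow]
    exact le_idem_sum (fun i => (f i * x i) * (M * P) ^ c) hi
  calc (M * P) ^ (c + 1) = P ^ (c + 1) * M ^ (c + 1) := by rw [mul_pow, mul_comm]
    _ ≤ (∑ i ∈ T, ∏ k ∈ T.erase i, x k) * M ^ (c + 1) := by gcongr
    _ = ∑ i ∈ T, (∏ k ∈ T.erase i, x k) * M ^ (c + 1) := Finset.sum_mul _ _ _
    _ ≤ _ := idem_sum_le fun i hi => ?_
  calc (∏ k ∈ T.erase i, x k) * M ^ (c + 1)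
      ≤ (∏ k ∈ T.erase i, x k) * (W i + ∑ k ∈ I.erase i, f k * M ^ c) := by
        gcongr; exact hM i (hT hi)
    _ = (∏ k ∈ T.erase i, x k) * W i +
        ∑ j ∈ I.erase i, (∏ k ∈ T.erase i, x k) * (f j * M ^ c) := by
        rw [mul_add, Finset.mul_sum]
    _ ≤ _ := add_le ((le_idem_sum (fun i => (∏ k ∈ T.erase i, x k) * W i) hi).trans hAle)
        (idem_sum_le fun j hj => ?_)
  have hjI := Finset.mem_of_mem_erase hj
  have hji := Finset.ne_of_mem_erase hj
  have hprod : ∀ S : Finset ι, S ⊆ T → ∏ k ∈ S, x k ≤ P ^ S.card := fun S hS =>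
    Finset.prod_le_pow_card _ _ _ fun k hk => hxP k (hT (hS hk))
  by_cases hjT : j ∈ T
  · have hj' : j ∈ T.erase i := Finset.mem_erase.2 ⟨hji, hjT⟩
    rw [← Finset.mul_prod_erase _ _ hj']
    refine le_trans ?_ (key j hjI)
    have h := hprod ((T.erase i).erase j) ((Finset.erase_subset _ _).trans (Finset.erase_subset _ _))
    rw [Finset.card_erase_of_mem hj', Finset.card_erase_of_mem hi, hTc] at h
    calc x j * (∏ k ∈ (T.erase i).erase j, x k) * (f j * M ^ c)
        ≤ x j * P ^ (c + 2 - 1 - 1) * (f j * M ^ c) := by gcongr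
      _ = _ := by simp only [Nat.add_one_sub_one]; ring
  · have h := hprod (T.erase i) (Finset.erase_subset _ _)
    rw [Finset.card_erase_of_mem hi, hTc] at h
    have hjk : j ≠ k₀ := by rintro rfl; exact hjT hk₀
    have hPx := hP j hjI k₀ (hT hk₀) hjk
    calc (∏ k ∈ T.erase i, x k) * (f j * M ^ c)
        ≤ P ^ (c + 1) * (f j * M ^ c) := by gcongr; exact h
      _ ≤ (x j * P ^ c + x k₀ ^ (c + 1)) * (f j * M ^ c) := by
        gcongr; rw [hPx]; exact add_pow_succ_le _ _ _
      _ = (f j * x j) * (M ^ c * P ^ c) + f j * x k₀ ^ (c + 1) * M ^ c := by ring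
      _ ≤ _ := add_le (key j hjI) ?_
    calc f j * x k₀ ^ (c + 1) * M ^ c
        ≤ f j * x k₀ ^ (c + 1) * (V j + ∑ k ∈ I.erase j, f k * N) := by
          gcongr; exact hV j hjI
      _ = f j * x k₀ ^ (c + 1) * V j +
          ∑ k ∈ I.erase j, f j * x k₀ ^ (c + 1) * (f k * N) := by
          rw [mul_add, Finset.mul_sum]
      _ ≤ _ := add_le ((le_idem_sum (fun i => (f i * x k₀ ^ (c + 1)) * V i)
          (Finset.mem_sdiff.2 ⟨hjI, hjT⟩)).trans hBle) (idem_sum_le fun k hk => ?_)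
    have hkI := Finset.mem_of_mem_erase hk
    have hkj := Finset.ne_of_mem_erase hk
    calc f j * x k₀ ^ (c + 1) * (f k * N)
        ≤ f j * P ^ (c + 1) * (f k * N) := by
          gcongr; exact hxP k₀ (hT hk₀)
      _ = f j * x j * (f k * N * P ^ c) + f k * x k * (f j * N * P ^ c) := by
          rw [pow_succ']
          nth_rw 1 [hP j hjI k hkI hkj.symm]
          ring
      _ ≤ _ := add_le ?_ ?_
    · refine le_trans ?_ (key j hjI)
      gcongr; exact hN k hkI
    · refine le_trans ?_ (key k hkI)
      gcongr; exact hN j hjI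

end IdemSemiring

/-! ### Eulerian numbers -/

/-- The recursion of the Eulerian numbers. -/
def eulerianBound : ℕ → ℕ → ℕ
  | 0, 0 => 1
  | 0, _ + 1 => 0
  | t + 1, 0 => eulerianBound t 0
  | t + 1, c + 1 => (c + 2) * eulerianBound t (c + 1) + (t - c) * eulerianBound t c

lemma eulerianBound_zero_right (t : ℕ) : eulerianBound t 0 = 1 := by
  induction t with
  | zero => rfl
  | succ t ih => simpa [eulerianBound] using ih

lemma eulerianBound_eq_zero (t : ℕ) : ∀ c, t ≤ c + 1 → eulerianBound t (c + 1) = 0 := by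
  induction t with
  | zero => intro c _; rfl
  | succ t ih =>
    intro c hc
    rw [eulerianBound, ih c (by omega), Nat.sub_eq_zero_of_le (by omega)]
    simp

/-- Entry `c` of row `t` enters row `t + 1` with weights `c + 1` and `t - c`, in total `t + 1`. For
`c > t` the truncated subtraction spoils this, but the entry is zero. -/
lemma sum_eulerianBound_le (t n : ℕ) : ∑ c ∈ Finset.range n, eulerianBound t c ≤ t ! := by
  induction t generalizing n with
  | zero =>
    obtain _ | n := n
    · simp
    · rw [Finset.sum_range_succ']
      simp [eulerianBound]
  | succ t ih =>
    obtain _ | n := n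
    · simp
    · have h : ∀ c, (c + 1) * eulerianBound t c + (t - c) * eulerianBound t c ≤
          (t + 1) * eulerianBound t c := by
        intro c
        rw [← add_mul]
        obtain hc | hc := le_or_gt c t
        · exact Nat.mul_le_mul_right _ (by omega)
        · obtain ⟨c, rfl⟩ : ∃ d, c = d + 1 := ⟨c - 1, by omega⟩
          simp [eulerianBound_eq_zero t c (by omega)]
      calc ∑ c ∈ Finset.range (n + 1), eulerianBound (t + 1) c
          = ∑ c ∈ Finset.range (n + 1), (c + 1) * eulerianBound t c +
            ∑ c ∈ Finset.range n, (t - c) * eulerianBound t c := by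
            rw [Finset.sum_range_succ', Finset.sum_range_succ']
            simp only [eulerianBound, Finset.sum_add_distrib]
            ring
        _ ≤ ∑ c ∈ Finset.range (n + 1), (c + 1) * eulerianBound t c +
            ∑ c ∈ Finset.range (n + 1), (t - c) * eulerianBound t c := by
            gcongr; exact Nat.le_succ n
        _ ≤ ∑ c ∈ Finset.range (n + 1), (t + 1) * eulerianBound t c := by
            rw [← Finset.sum_add_distrib]
            exact Finset.sum_le_sum fun c _ => h c
        _ ≤ (t + 1) * t ! := by
            rw [← Finset.mul_sum]
            exact Nat.mul_le_mul_left _ (ih _)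
        _ = _ := (Nat.factorial_succ t).symm

/-! ### A Bézout bound by counting dimensions -/

section Bezout

variable {F A ι : Type*} [Field F] [CommRing A] [Algebra F A] [Module.Finite F A]

open Module Submodule

lemma finrank_span_singleton_mul_le (a : A) (W : Submodule F A) :
    finrank F (span F {a} * W : Submodule F A) ≤ finrank F W := by
  have h : span F {a} * W = W.map (LinearMap.mulLeft F a) := by
    ext y
    simp [mem_span_singleton_mul]
  rw [h]
  exact finrank_map_le _ _

lemma finrank_submodule_sum_le (s : Finset ι) (W : ι → Submodule F A) (n : ℕ)
    (h : ∀ i ∈ s, finrank F (W i) ≤ n) :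
    finrank F (∑ i ∈ s, W i : Submodule F A) ≤ s.card * n := by
  classical
  induction s using Finset.induction_on with
  | empty =>
    rw [Finset.sum_empty]
    exact (finrank_bot F A).le.trans (Nat.zero_le _)
  | insert i s hi ih =>
    rw [Finset.sum_insert hi, Finset.card_insert_of_notMem hi, add_mul, one_mul, add_comm]
    refine (finrank_add_le_finrank_add_finrank _ _).trans ?_
    have := ih fun j hj => h j (Finset.mem_insert_of_mem hj)
    have := h i (Finset.mem_insert_self _ _)
    omega

/-- Models the Segre variety of `(ℙ¹)^t`, whose h-vector is Eulerian: `W` covers degree `c + 1`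
modulo the `t + 1` products. Induction on `t` drops one coordinate and one index of `I`. -/
lemma exists_finrank_le_eulerianBound [DecidableEq ι] (t : ℕ) :
    ∀ (c : ℕ) (I : Finset ι) (_ : I.card = t + 1) (l : ι → Fin t → A) (P : Fin t → Submodule F A)
      (_ : ∀ j, ∀ i ∈ I, ∀ k ∈ I, i ≠ k → P j = span F {l i j} + span F {l k j}),
      ∃ W : Submodule F A, finrank F W ≤ eulerianBound t (c + 1) ∧
        (∏ j, P j) ^ (c + 1) ≤ W + ∑ i ∈ I, span F {∏ j, l i j} * (∏ j, P j) ^ c := by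
  induction t with
  | zero =>
    intro c I hI l P _
    obtain ⟨i, hi⟩ : I.Nonempty := Finset.card_pos.1 (by omega)
    refine ⟨⊥, by simp, ?_⟩
    refine le_trans ?_ le_add_self
    refine le_trans ?_ (le_idem_sum (fun i => span F {∏ j, l i j} * (∏ j, P j) ^ c) hi)
    simp [← one_eq_span]
  | succ t ih =>
    have main : ∀ (c : ℕ) (I : Finset ι) (_ : I.card = t + 1 + 1) (l : ι → Fin (t + 1) → A)
        (P : Fin (t + 1) → Submodule F A)
        (_ : ∀ j, ∀ i ∈ I, ∀ k ∈ I, i ≠ k → P j = span F {l i j} + span F {l k j}), c ≤ t →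
        ∃ W : Submodule F A, finrank F W ≤ eulerianBound (t + 1) (c + 1) ∧
          (∏ j, P j) ^ (c + 1) ≤ W + ∑ i ∈ I, span F {∏ j, l i j} * (∏ j, P j) ^ c := by
      intro c I hI l P hP hct
      obtain ⟨T, hTI, hTc⟩ := Finset.exists_subset_card_eq (s := I) (n := c + 2) (by omega)
      obtain ⟨k₀, hk₀⟩ : T.Nonempty := Finset.card_pos.1 (by omega)
      have hcard : ∀ i ∈ I, (I.erase i).card = t + 1 := fun i hi => by
        rw [Finset.card_erase_of_mem hi]; omega
      have hP' : ∀ i ∈ I, ∀ j : Fin t, ∀ a ∈ I.erase i, ∀ b ∈ I.erase i, a ≠ b →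
          P j.succ = span F {l a j.succ} + span F {l b j.succ} := fun i _ j a ha b hb =>
        hP _ _ (Finset.mem_of_mem_erase ha) _ (Finset.mem_of_mem_erase hb)
      set M := ∏ j : Fin t, P j.succ with hMdef
      set f : ι → Submodule F A := fun i => span F {∏ j : Fin t, l i j.succ} with hf
      have hW : ∀ i, ∃ W : Submodule F A, i ∈ I → (finrank F W ≤ eulerianBound t (c + 1) ∧
          M ^ (c + 1) ≤ W + ∑ k ∈ I.erase i, f k * M ^ c) := by
        intro i
        by_cases hi : i ∈ I
        · obtain ⟨W, hW⟩ := ih c (I.erase i) (hcard i hi) (fun i j => l i j.succ)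
            (fun j => P j.succ) (hP' i hi)
          exact ⟨W, fun _ => hW⟩
        · exact ⟨⊥, fun h => absurd h hi⟩
      choose W hW using hW
      have hfM : ∀ k ∈ I, f k ≤ M := by
        intro k hk
        change span F {∏ j : Fin t, l k j.succ} ≤ M
        rw [← prod_span_singleton]
        refine Finset.prod_le_prod' fun j _ => ?_
        obtain ⟨i, hi, hik⟩ := Finset.exists_mem_ne (by omega : 1 < I.card) k
        rw [hP _ k hk i hi hik.symm]
        exact le_self_add
      -- In degree `0` there is no ideal part: `N = 0`, and `V = 1` is spanned by one element.
      -- Otherwise `N` is the preceding power of `M`.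
      have hV : ∃ N : Submodule F A, (∀ k ∈ I, f k * N ≤ M ^ c) ∧
          ∀ i, ∃ V : Submodule F A, i ∈ I → (finrank F V ≤ eulerianBound t c ∧
            M ^ c ≤ V + ∑ k ∈ I.erase i, f k * N) := by
        obtain _ | c := c
        · refine ⟨0, by simp, fun i => ⟨1, fun _ => ⟨?_, by simp⟩⟩⟩
          rw [eulerianBound_zero_right, one_eq_span]
          exact (finrank_span_le_card _).trans (by simp)
        · refine ⟨M ^ c, fun k hk => ?_, fun i => ?_⟩
          · rw [pow_succ']
            exact mul_le_mul' (hfM k hk) le_rfl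
          · by_cases hi : i ∈ I
            · obtain ⟨V, hV⟩ := ih c (I.erase i) (hcard i hi) (fun i j => l i j.succ)
                (fun j => P j.succ) (hP' i hi)
              exact ⟨V, fun _ => hV⟩
            · exact ⟨⊥, fun h => absurd h hi⟩
      obtain ⟨N, hN, hV⟩ := hV
      choose V hV using hV
      have step := mul_pow_succ_le_add_sum I T hTI c hTc (fun i => span F {l i 0}) f W V (P 0) M N
        (hP 0) (fun i hi => (hW i hi).2) (fun i hi => (hV i hi).2) hN k₀ hk₀
      have hprod : ∏ j, P j = M * P 0 := by rw [Fin.prod_univ_succ, mul_comm]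
      have hfl : ∀ i, span F {∏ j, l i j} = f i * span F {l i 0} := fun i => by
        rw [hf, span_mul_span, Set.singleton_mul_singleton, Fin.prod_univ_succ, mul_comm]
      rw [hprod]
      simp only [hfl]
      refine ⟨_, ?_, step⟩
      refine (finrank_add_le_finrank_add_finrank _ _).trans ?_
      rw [eulerianBound]
      refine add_le_add ?_ ?_
      · rw [← hTc]
        refine finrank_submodule_sum_le _ _ _ fun i hi => ?_
        rw [prod_span_singleton]
        exact (finrank_span_singleton_mul_le _ _).trans (hW i (hTI hi)).1
      · have hcs : (I \ T).card = t - c := by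
          rw [Finset.card_sdiff_of_subset hTI]; omega
        rw [← hcs]
        refine finrank_submodule_sum_le _ _ _ fun i hi => ?_
        rw [span_pow, Set.singleton_pow, hf, span_mul_span, Set.singleton_mul_singleton]
        exact (finrank_span_singleton_mul_le _ _).trans (hV i (Finset.mem_sdiff.1 hi).1).1
    intro c I hI l P hP
    obtain hc | hc := le_or_gt c t
    · exact main c I hI l P hP hc
    -- Here `I` is too small for `c + 2` indices. But in degree `t + 1` the Eulerian number
    -- vanishes, so the ideal is everything there, and multiplying by a power carries this to all
    -- higher degrees.
    · obtain ⟨W, hW, h⟩ := main t I hI l P hP le_rfl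
      rw [eulerianBound_eq_zero _ _ le_rfl, Nat.le_zero, Submodule.finrank_eq_zero] at hW
      subst hW
      refine ⟨⊥, by simp, ?_⟩
      obtain ⟨d, rfl⟩ : ∃ d, c = t + d := ⟨c - t, by omega⟩
      refine le_trans ?_ le_add_self
      rw [show t + d + 1 = (t + 1) + d by ring, pow_add]
      calc (∏ j, P j) ^ (t + 1) * (∏ j, P j) ^ d
          ≤ (∑ i ∈ I, span F {∏ j, l i j} * (∏ j, P j) ^ t) * (∏ j, P j) ^ d := by
            gcongr
            refine h.trans (add_le bot_le le_rfl)
        _ = _ := by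
          rw [Finset.sum_mul]
          exact Finset.sum_congr rfl fun i _ => by rw [pow_add, mul_assoc]

/-- A multilinear Bézout bound: if the `t + 1` products of linear forms are multiples of a single
element, then the algebra generated by the forms has dimension at most `t!`. -/
theorem finrank_prod_pow_le_factorial [DecidableEq ι] (t : ℕ) (I : Finset ι) (hI : I.card = t + 1)
    (l : ι → Fin t → A) (P : Fin t → Submodule F A)
    (hP : ∀ j, ∀ i ∈ I, ∀ k ∈ I, i ≠ k → P j = span F {l i j} + span F {l k j}) (z : A)
    (hz : ∀ i ∈ I, ∏ j, l i j ∈ span F {z}) (c : ℕ) :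
    finrank F ((∏ j, P j) ^ c : Submodule F A) ≤ t ! := by
  -- All products lie in the line of `z`, so the ideal part of degree `c + 1` lies in `z` times
  -- degree `c` and has no larger dimension. Each degree thus adds at most one Eulerian number.
  suffices h : finrank F ((∏ j, P j) ^ c : Submodule F A) ≤
      ∑ d ∈ Finset.range (c + 1), eulerianBound t d from h.trans (sum_eulerianBound_le _ _)
  induction c with
  | zero =>
    simp only [zero_add, Finset.sum_range_one, eulerianBound_zero_right]
    rw [show (∏ j, P j) ^ 0 = (1 : Submodule F A) from pow_zero _, one_eq_span]
    exact (finrank_span_le_card _).trans (by simp)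
  | succ c ih =>
    obtain ⟨W, hW, h⟩ := exists_finrank_le_eulerianBound t c I hI l P hP
    have h2 : (∏ j, P j) ^ (c + 1) ≤ W + span F {z} * (∏ j, P j) ^ c := by
      refine h.trans (add_le le_self_add (le_trans ?_ le_add_self))
      refine idem_sum_le fun i hi => ?_
      exact mul_le_mul' ((span_singleton_le_iff_mem _ _).2 (hz i hi)) le_rfl
    rw [Finset.sum_range_succ]
    refine (finrank_mono h2).trans ((finrank_add_le_finrank_add_finrank _ _).trans ?_)
    have := finrank_span_singleton_mul_le (F := F) z ((∏ j, P j) ^ c)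
    omega

end Bezout

/-! ### Multilinear systems -/

section NormSystem

open Submodule Module

/-- A system of `t + 1` multilinear equations in `t` unknowns and an auxiliary scale `z` has at most
`t!` solutions. -/
theorem card_le_factorial_of_prod_add_eq {K ι S : Type*} [Field K] [DecidableEq ι] [Fintype S]
    [DecidableEq S] {t : ℕ} (I : Finset ι) (hI : I.card = t + 1) (y : S → Fin t → K) (j₀ : Fin t)
    (hy : Function.Injective fun s => y s j₀) (a : ι → Fin t → K)
    (ha : ∀ j, ∀ i ∈ I, ∀ k ∈ I, i ≠ k → a i j ≠ a k j) (α : ι → K) (z : S → K)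
    (h : ∀ i ∈ I, ∀ s, ∏ j, (y s j + a i j) = α i * z s) : Fintype.card S ≤ t ! := by
  -- The algebra is that of all functions on the solution set. Distinct shifts make any two of the
  -- forms in coordinate `j` span the same plane as `1` and `y_j`.
  set l : ι → Fin t → (S → K) := fun i j s => y s j + a i j with hl
  set P : Fin t → Submodule K (S → K) := fun j => span K {1, fun s => y s j} with hPdef
  have hP : ∀ j, ∀ i ∈ I, ∀ k ∈ I, i ≠ k → P j = span K {l i j} + span K {l k j} := by
    intro j i hi k hk hik
    have hne : a i j - a k j ≠ 0 := sub_ne_zero.2 (ha j i hi k hk hik)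
    rw [Submodule.add_eq_sup, ← span_union, Set.singleton_union]
    refine le_antisymm (span_le.2 ?_) (span_le.2 ?_)
    · rintro f (rfl | rfl) <;> rw [SetLike.mem_coe, mem_span_pair]
      · refine ⟨(a i j - a k j)⁻¹, -(a i j - a k j)⁻¹, ?_⟩
        ext s
        simp only [hl, Pi.add_apply, Pi.smul_apply, smul_eq_mul, Pi.one_apply]
        field_simp
        ring
      · refine ⟨-a k j * (a i j - a k j)⁻¹, a i j * (a i j - a k j)⁻¹, ?_⟩
        ext s
        simp only [hl, Pi.add_apply, Pi.smul_apply, smul_eq_mul]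
        field_simp
        ring
    · rintro f (rfl | rfl) <;> rw [SetLike.mem_coe, mem_span_pair]
      · refine ⟨a i j, 1, ?_⟩
        ext s
        simp [hl, add_comm]
      · refine ⟨a k j, 1, ?_⟩
        ext s
        simp [hl, add_comm]
  have hone : ∀ j, (1 : Submodule K (S → K)) ≤ P j := fun j => by
    rw [Submodule.one_le]
    exact subset_span (Set.mem_insert _ _)
  have hyP : (fun s => y s j₀) ∈ P j₀ := subset_span (Set.mem_insert_of_mem _ rfl)
  have hPM : P j₀ ≤ ∏ j, P j := by
    rw [← Finset.mul_prod_erase _ _ (Finset.mem_univ j₀)]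
    exact le_mul_of_one_le_right' (Finset.one_le_prod' fun j _ => hone j)
  -- Coordinate `j₀` separates the solutions, so by Lagrange interpolation every function is a
  -- polynomial in it of degree below `card S`; hence a high power has dimension `card S`.
  have htop : (⊤ : Submodule K (S → K)) ≤ (∏ j, P j) ^ Fintype.card S := by
    intro g _
    have hinj : Set.InjOn (fun s => y s j₀) (Finset.univ : Finset S) := hy.injOn
    set p := Lagrange.interpolate Finset.univ (fun s => y s j₀) g with hp
    have hdeg : p.degree < Fintype.card S := Lagrange.degree_interpolate_lt g hinj
    have hgp : g = ∑ k ∈ Finset.range (Fintype.card S), p.coeff k • (fun s => y s j₀) ^ k := by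
      ext s
      have h1 : p.eval (y s j₀) = g s :=
        Lagrange.eval_interpolate_at_node g hinj (Finset.mem_univ s)
      have h2 : p.natDegree < Fintype.card S := by
        by_cases hp0 : p = 0
        · rw [hp0, Polynomial.natDegree_zero]
          exact Fintype.card_pos_iff.2 ⟨s⟩
        · exact (Polynomial.natDegree_lt_iff_degree_lt hp0).2 hdeg
      rw [← h1, Polynomial.eval_eq_sum_range' h2]
      simp
    rw [hgp]
    refine sum_mem fun k hk => smul_mem _ _ ?_
    have hk' := (Finset.mem_range.1 hk).le
    refine (pow_le_pow_right' ((hone j₀).trans hPM) hk' :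
      (∏ j, P j) ^ k ≤ (∏ j, P j) ^ Fintype.card S) ?_
    exact pow_mem_pow _ (hPM hyP) k
  have hz : ∀ i ∈ I, ∏ j, l i j ∈ span K {z} := by
    intro i hi
    rw [mem_span_singleton]
    refine ⟨α i, ?_⟩
    ext s
    simp [hl, Finset.prod_apply, h i hi s]
  have := finrank_prod_pow_le_factorial t I hI l P hP z hz (Fintype.card S)
  rw [eq_top_iff.2 htop, finrank_top, finrank_fintype_fun_eq_card] at this
  exact this

end NormSystem

/-! ### The norm-graph colouring -/

section NormGraph

variable (p t : ℕ) [Fact p.Prime]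

/-- The vertices of the projective norm graph. -/
abbrev NormVertex : Type := GaloisField p t × (ZMod p)ˣ

open Classical in
/-- The colouring of the pairs of vertices of the projective norm graph by the ratio of the norm of
the sum and the product of the weights. -/
noncomputable def normColor (v w : NormVertex p t) : (ZMod p)ˣ × Bool :=
  -- Pairs without a nonzero norm get separate colours, in which one end determines the other.
  if h : v.1 + w.1 = 0 then (v.2 * w.2, true) else
    (Units.mk0 (Algebra.norm (ZMod p) (v.1 + w.1)) (Algebra.norm_ne_zero_iff.2 h) /
      (v.2 * w.2), false)

lemma normColor_comm (v w : NormVertex p t) : normColor p t v w = normColor p t w v := by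
  unfold normColor
  by_cases h : v.1 + w.1 = 0
  · rw [dif_pos h, dif_pos (by rwa [add_comm]), mul_comm]
  · rw [dif_neg h, dif_neg (by rwa [add_comm])]
    simp only [add_comm w.1, mul_comm w.2]

variable {p t}

lemma norm_eq_prod_pow (ht : t ≠ 0) (x : GaloisField p t) :
    algebraMap (ZMod p) _ (Algebra.norm (ZMod p) x) = ∏ j : Fin t, x ^ p ^ (j : ℕ) := by
  have : Finite (GaloisField p t) := inferInstance
  rw [FiniteField.algebraMap_norm_eq_prod_pow, GaloisField.finrank p ht, Nat.card_zmod,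
    Finset.prod_range]

/-- The norm is the product of the Frobenius conjugates, which are additive, so a common neighbour
`w` solves a multilinear system in the conjugates of `w.1`, with scale `c * w.2`. Equal field
coordinates would force equal weights, which gives the required distinctness. -/
lemma card_le_factorial_of_normColor_eq (ht : t ≠ 0) (v : Fin (t + 1) → NormVertex p t)
    (hv : Function.Injective v) (W : Finset (NormVertex p t)) (c : (ZMod p)ˣ × Bool)
    (h : ∀ i, ∀ w ∈ W, normColor p t (v i) w = c) : W.card ≤ t ! := by
  classical
  obtain rfl | ⟨w₀, hw₀⟩ := W.eq_empty_or_nonempty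
  · simp
  have h01 : (0 : Fin (t + 1)) ≠ Fin.last t := by
    rw [Ne, Fin.ext_iff]
    simpa using ht.symm
  obtain ⟨c, _ | _⟩ := c
  swap
  · exfalso
    have key : ∀ i, (v i).1 = - w₀.1 ∧ (v i).2 = c / w₀.2 := by
      intro i
      have hi := h i w₀ hw₀
      unfold normColor at hi
      split_ifs at hi with h0
      · rw [Prod.mk.injEq] at hi
        exact ⟨eq_neg_of_add_eq_zero_left h0, eq_div_of_mul_eq' hi.1⟩
      · simp at hi
    exact h01 (hv (Prod.ext ((key 0).1.trans (key _).1.symm) ((key 0).2.trans (key _).2.symm)))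
  have key : ∀ i, ∀ w ∈ W, Algebra.norm (ZMod p) ((v i).1 + w.1) =
      (((v i).2 : (ZMod p)ˣ) : ZMod p) * (((c * w.2 : (ZMod p)ˣ)) : ZMod p) := by
    intro i w hw
    have hi := h i w hw
    unfold normColor at hi
    split_ifs at hi with h0
    · simp at hi
    · rw [Prod.mk.injEq] at hi
      have := div_eq_iff_eq_mul.1 hi.1
      have h1 := congrArg Units.val this
      rw [Units.val_mk0] at h1
      rw [h1]
      push_cast
      ring
  have hinj : Function.Injective (algebraMap (ZMod p) (GaloisField p t)) :=
    (algebraMap (ZMod p) (GaloisField p t)).injective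
  have hfrob : ∀ j : ℕ, Function.Injective fun x : GaloisField p t => x ^ p ^ j := fun j =>
    iterateFrobenius_inj (GaloisField p t) p j
  have hcard := card_le_factorial_of_prod_add_eq (K := GaloisField p t) (S := W)
    (Finset.univ : Finset (Fin (t + 1))) (by simp) (fun w j => w.1.1 ^ p ^ (j : ℕ))
    ⟨0, Nat.pos_of_ne_zero ht⟩ ?_ (fun i j => (v i).1 ^ p ^ (j : ℕ)) ?_
    (fun i => algebraMap (ZMod p) _ ((v i).2 : ZMod p))
    (fun w => algebraMap (ZMod p) _ ((c * w.1.2 : (ZMod p)ˣ) : ZMod p)) ?_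
  · simpa using hcard
  · rintro ⟨w, hw⟩ ⟨w', hw'⟩ hww
    have hww1 : w.1 = w'.1 := by simpa using hww
    have h1 := key 0 w hw
    have h2 := key 0 w' hw'
    rw [hww1, h2] at h1
    have h3 := mul_left_cancel₀ (Units.ne_zero _) h1
    have h4 := mul_left_cancel (Units.ext h3)
    exact Subtype.ext (Prod.ext hww1 h4.symm)
  · intro j i _ k _ hik heq
    have hik1 : (v i).1 = (v k).1 := hfrob j heq
    have h1 := key i w₀ hw₀
    have h2 := key k w₀ hw₀
    rw [hik1, h2] at h1
    have h3 := mul_right_cancel₀ (Units.ne_zero _) h1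
    exact hik (hv (Prod.ext hik1 (Units.ext h3).symm))
  · rintro i _ ⟨w, hw⟩
    rw [← map_mul, ← key i w hw, norm_eq_prod_pow ht]
    refine Finset.prod_congr rfl fun j _ => ?_
    rw [add_comm, add_pow_char_pow]

end NormGraph

/-- The pairs of `2 ^ (b * s)` points can be coloured symmetrically with `2 ^ (s + 2)` colours
without a monochromatic complete bipartite graph `K_{a,b}`. -/
theorem exists_coloring_biclique_free {a b : ℕ} (hb : 2 ≤ b) (ha : (b - 1)! < a) (s : ℕ)
    (V : Type*) [Fintype V] (hV : Fintype.card V = (2 ^ b) ^ s) :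
    ∃ χ : V → V → Fin (2 ^ (s + 2)), (∀ x y, χ x y = χ y x) ∧
      ∀ (u : Fin a → V) (w : Fin b → V) (c : Fin (2 ^ (s + 2))), Function.Injective u →
        Function.Injective w → ¬ ∀ i j, χ (u i) (w j) = c := by
  classical
  obtain ⟨t, rfl⟩ : ∃ t, b = t + 1 := ⟨b - 1, by omega⟩
  have ht : t ≠ 0 := by omega
  -- Bertrand: `2 ^ s < p ≤ 2 ^ (s + 1)` leaves room for `2 ^ (s * (t + 1))` vertices in `p ^ t * (p
  -- - 1)`, and for the `2 * (p - 1)` colours in `2 ^ (s + 2)`.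
  obtain ⟨p, hp, hps, hps2⟩ := Nat.exists_prime_lt_and_le_two_mul (2 ^ s) (by positivity)
  have : Fact p.Prime := ⟨hp⟩
  have : Fintype (GaloisField p t) := Fintype.ofFinite _
  have hcard : Fintype.card (NormVertex p t) = p ^ t * (p - 1) := by
    rw [Fintype.card_prod, ZMod.card_units, ← Nat.card_eq_fintype_card, GaloisField.card p t ht]
  have h1 : Fintype.card V ≤ Fintype.card (NormVertex p t) := by
    rw [hV, hcard, ← pow_mul, mul_comm, pow_mul, pow_succ]
    exact Nat.mul_le_mul (Nat.pow_le_pow_left hps.le _) (by omega)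
  have h2 : Fintype.card ((ZMod p)ˣ × Bool) ≤ Fintype.card (Fin (2 ^ (s + 2))) := by
    rw [Fintype.card_prod, ZMod.card_units, Fintype.card_bool, Fintype.card_fin, pow_succ, pow_succ]
    omega
  obtain ⟨f⟩ := Function.Embedding.nonempty_of_card_le h1
  obtain ⟨g⟩ := Function.Embedding.nonempty_of_card_le h2
  refine ⟨fun x y => g (normColor p t (f x) (f y)), fun x y => congrArg g (normColor_comm p t _ _), ?_⟩
  intro u w c hu hw h
  have hne : 0 < a := by omega
  have := card_le_factorial_of_normColor_eq ht (fun i => f (w i)) (f.injective.comp hw)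
    (Finset.univ.image fun i => f (u i)) (normColor p t (f (u ⟨0, hne⟩)) (f (w 0))) (by
      intro j x hx
      obtain ⟨i, -, rfl⟩ := Finset.mem_image.1 hx
      rw [normColor_comm]
      exact g.injective ((h i j).trans (h _ _).symm))
  rw [Finset.card_image_of_injective (f := fun i => f (u i)) _ (f.injective.comp hu), Finset.card_univ,
    Fintype.card_fin] at this
  simp only [Nat.add_sub_cancel] at ha
  omega

/-! ### Berge copies as indexed families of finite sets -/

namespace Hypergraph

/-- A family `E` of sets is a Berge copy of the complete bipartite graph `K_{a,b}` with pairwise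
distinct core vertices `u i`, `w j`. -/
structure IsBergeBiclique {V : Type*} {a b : ℕ} (u : Fin a → V) (w : Fin b → V)
    (E : Fin a → Fin b → Finset V) : Prop where
  injective_left : Function.Injective u
  injective_right : Function.Injective w
  left_ne_right : ∀ i j, u i ≠ w j
  edge_inj : ∀ i j i' j', E i j = E i' j' → i = i' ∧ j = j'
  left_mem : ∀ i j, u i ∈ E i j
  right_mem : ∀ i j, w j ∈ E i j

/-- The set family `𝓗` contains a Berge copy of `K_{a,b}`. -/
def HasBergeBiclique {V : Type*} (a b : ℕ) (𝓗 : Set (Finset V)) : Prop :=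
  ∃ (u : Fin a → V) (w : Fin b → V) (E : Fin a → Fin b → Finset V),
    IsBergeBiclique u w E ∧ ∀ i j, E i j ∈ 𝓗

lemma IsRamsey.hasBergeBiclique {r a b k n : ℕ}
    (h : IsRamsey r (bergeFamily (completeBipartiteGraph (Fin a) (Fin b))) k n)
    (c : Finset (Fin n) → Fin k) : ∃ i, HasBergeBiclique a b {e | e.card = r ∧ c e = i} := by
  classical
  obtain ⟨i, α, F, ⟨f, hf, hfV, g, hg⟩, m, hm, -, hE⟩ := h fun e => c (e : Set (Fin n)).toFinset
  have hedge : ∀ x y, s(Sum.inl x, Sum.inr y) ∈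
      (completeBipartiteGraph (Fin a) (Fin b)).edgeSet := fun x y => by
    simp [completeBipartiteGraph]
  have hsub : ∀ e, (g e : Set α) ⊆ F.vertexSet := fun e =>
    F.subset_vertexSet_of_mem_edgeSet' (g e).2
  have hinj : Function.Injective fun x => m (f x) := fun x y hxy =>
    hf (hm (hfV x) (hfV y) hxy)
  refine ⟨i, fun x => m (f (Sum.inl x)), fun y => m (f (Sum.inr y)),
    fun x y => (m '' (g ⟨_, hedge x y⟩ : Set α)).toFinset, ⟨fun x x' hx => ?_, fun x x' hx => ?_,
    fun x y hxy => ?_, fun x y x' y' hxy => ?_, fun x y => ?_, fun x y => ?_⟩, fun x y => ?_⟩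
  · exact Sum.inl_injective (hinj hx)
  · exact Sum.inr_injective (hinj hx)
  · exact Sum.inl_ne_inr (hinj hxy)
  · rw [Set.toFinset_inj] at hxy
    have h1 := (hm.image_eq_image_iff (hsub _) (hsub _)).1 hxy
    have h2 := g.injective (Subtype.ext h1)
    simpa using h2
  · rw [Set.mem_toFinset]
    exact Set.mem_image_of_mem _ (hg ⟨_, hedge x y⟩ _ (by simp))
  · rw [Set.mem_toFinset]
    exact Set.mem_image_of_mem _ (hg ⟨_, hedge x y⟩ _ (by simp))
  · obtain ⟨h1, h2⟩ := hE (image_mem_edgeSet_image (g ⟨_, hedge x y⟩).2)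
    refine ⟨?_, h2⟩
    rw [← Set.ncard_eq_toFinset_card']
    exact h1

lemma isRamsey_of_hasBergeBiclique {r a b k n : ℕ} (hk : 0 < k)
    (h : ∀ c : Finset (Fin n) → Fin k, ∃ i, HasBergeBiclique a b {e | e.card = r ∧ c e = i}) :
    IsRamsey r (bergeFamily (completeBipartiteGraph (Fin a) (Fin b))) k n := by
  classical
  intro c
  obtain ⟨i, u, w, E, hE, hmem⟩ := h fun e =>
    if he : (e : Set (Fin n)) ∈ (completeUniform n r).edgeSet then c ⟨e, he⟩ else ⟨0, hk⟩
  have hcol : ∀ x y, (E x y : Set (Fin n)) ∈ ((completeUniform n r).colorClass c i).edgeSet := by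
    intro x y
    obtain ⟨h1, h2⟩ := hmem x y
    have he : (E x y : Set (Fin n)) ∈ (completeUniform n r).edgeSet := by
      change (E x y : Set (Fin n)).ncard = r
      rw [Set.ncard_coe_finset, h1]
    rw [dif_pos he] at h2
    exact ⟨he, h2⟩
  let G := completeBipartiteGraph (Fin a) (Fin b)
  have hG : ∀ e : G.edgeSet, ∃ p : Fin a × Fin b, (e : Sym2 _) = s(Sum.inl p.1, Sum.inr p.2) := by
    rintro ⟨e, he⟩
    induction e using Sym2.ind with
    | _ x y =>
      rw [SimpleGraph.mem_edgeSet] at he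
      obtain x | x := x <;> obtain y | y := y
      · simp [G] at he
      · exact ⟨(x, y), rfl⟩
      · exact ⟨(y, x), Sym2.eq_swap⟩
      · simp [G] at he
  choose p hp using hG
  -- A Berge copy may have no further edges, so the subgraph keeps only the selected ones.
  let T : Set (Set (Fin n)) := Set.range fun e : G.edgeSet => (E (p e).1 (p e).2 : Set (Fin n))
  have hinj : Function.Injective fun e : G.edgeSet => (E (p e).1 (p e).2 : Set (Fin n)) := by
    intro e e' hee
    obtain ⟨h1, h2⟩ := hE.edge_inj _ _ _ _ (Finset.coe_injective hee)
    apply Subtype.ext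
    rw [hp e, hp e', h1, h2]
  refine ⟨i, Fin n, ⟨Set.univ, T, fun _ _ => Set.subset_univ _⟩, ⟨Sum.elim u w, ?_,
    fun _ => Set.mem_univ _, Equiv.ofInjective _ hinj, ?_⟩, id, Set.injOn_id _, ?_, ?_⟩
  · rintro (x | x) (y | y) hxy
    · rw [hE.injective_left hxy]
    · exact absurd hxy (hE.left_ne_right x y)
    · exact absurd hxy.symm (hE.left_ne_right y x)
    · rw [hE.injective_right hxy]
  · intro e x hx
    rw [hp e, Sym2.mem_iff] at hx
    obtain rfl | rfl := hx
    · exact hE.left_mem _ _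
    · exact hE.right_mem _ _
  · exact Set.subset_univ _
  · rintro - ⟨-, ⟨e, rfl⟩, rfl⟩
    rw [Set.image_id]
    exact hcol _ _

end Hypergraph

/-! ### Greedy colouring of index sets -/

/-- A symmetric relation of degree at most `d` on a finite set has a proper colouring with `d + 1`
colours. -/
lemma exists_greedy_coloring {α : Type*} [DecidableEq α] (S : Finset α) (R : α → α → Prop)
    [DecidableRel R] (hR : ∀ x y, R x y → R y x) (d : ℕ)
    (hd : ∀ x ∈ S, (S.filter (R x)).card ≤ d) :
    ∃ κ : α → Fin (d + 1), ∀ x ∈ S, ∀ y ∈ S, x ≠ y → R x y → κ x ≠ κ y := by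
  induction S using Finset.induction_on with
  | empty => exact ⟨fun _ => 0, by simp⟩
  | insert v S hv ih =>
    obtain ⟨κ, hκ⟩ := ih fun x hx => (Finset.card_le_card
      (Finset.filter_subset_filter _ (Finset.subset_insert _ _))).trans
        (hd x (Finset.mem_insert_of_mem hx))
    have hlt : ((S.filter (R v)).image κ).card < (Finset.univ : Finset (Fin (d + 1))).card := by
      rw [Finset.card_univ, Fintype.card_fin, Nat.lt_succ_iff]
      exact Finset.card_image_le.trans ((Finset.card_le_card
        (Finset.filter_subset_filter _ (Finset.subset_insert _ _))).trans
        (hd v (Finset.mem_insert_self _ _)))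
    obtain ⟨c, -, hc⟩ := Finset.exists_mem_notMem_of_card_lt_card hlt
    have hc' : ∀ y ∈ S, R v y → κ y ≠ c := fun y hy hvy hyc =>
      hc (Finset.mem_image.2 ⟨y, Finset.mem_filter.2 ⟨hy, hvy⟩, hyc⟩)
    have hne : ∀ y ∈ S, y ≠ v := fun y hy h => hv (h ▸ hy)
    refine ⟨Function.update κ v c, fun x hx y hy hxy hRxy => ?_⟩
    rw [Finset.mem_insert] at hx hy
    obtain rfl | hx := hx <;> obtain rfl | hy := hy
    · exact absurd rfl hxy
    · rw [Function.update_self, Function.update_of_ne (hne y hy)]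
      exact (hc' y hy hRxy).symm
    · rw [Function.update_self, Function.update_of_ne (hne x hx)]
      exact hc' x hx (hR _ _ hRxy)
    · rw [Function.update_of_ne (hne x hx), Function.update_of_ne (hne y hy)]
      exact hκ x hx y hy hxy hRxy

/-- The `r`-subsets of `{0, …, B - 1}` that have two elements in the same interval of length `D`
can be coloured with `O(B ^ (r - 2))` colours so that sets of the same colour are disjoint. -/
lemma exists_coloring_disjoint (r D B : ℕ) (hr : 2 ≤ r) (hD : 0 < D) (hB : 0 < B) :
    ∃ κ : Finset ℕ → Fin ((r * ((r - 1) * D) + 1) * B ^ (r - 2)),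
      ∀ J J' : Finset ℕ, J ⊆ Finset.range B → J' ⊆ Finset.range B → J.card = r → J'.card = r →
        (∃ y ∈ J, ∃ y' ∈ J, y ≠ y' ∧ y / D = y' / D) →
        (∃ y ∈ J', ∃ y' ∈ J', y ≠ y' ∧ y / D = y' / D) →
        κ J = κ J' → (∃ v ∈ J, v ∈ J') → J = J' := by
  classical
  set S : Finset (Finset ℕ) := (Finset.powersetCard r (Finset.range B)).filter
    fun J => ∃ y ∈ J, ∃ y' ∈ J, y ≠ y' ∧ y / D = y' / D with hS
  have hmemS : ∀ J, J ∈ S ↔ (J ⊆ Finset.range B ∧ J.card = r) ∧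
      ∃ y ∈ J, ∃ y' ∈ J, y ≠ y' ∧ y / D = y' / D := fun J => by
    rw [hS, Finset.mem_filter, Finset.mem_powersetCard]
  have hdeg : ∀ J ∈ S, (S.filter fun J' => ∃ v ∈ J, v ∈ J').card ≤
      r * ((r - 1) * D) * B ^ (r - 2) := by
    intro J hJ
    -- Code for a `J'` meeting `J`: a common element `v`, the `r - 2` elements other than `v` and
    -- `y'`, and `y'` itself through its residue mod `D` and the name of an element `y` in its
    -- interval (`none` meaning `v`).
    let X := J × (Option (Fin (r - 2)) × Fin D) × (Fin (r - 2) → Fin B)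
    let F : X → Finset ℕ := fun x =>
      insert (x.1 : ℕ) (insert (x.2.1.1.elim (x.1 : ℕ) (fun k => (x.2.2 k : ℕ)) / D * D + x.2.1.2)
        (Finset.univ.image fun k => (x.2.2 k : ℕ)))
    have hsub : (S.filter fun J' => ∃ v ∈ J, v ∈ J') ⊆ (Finset.univ : Finset X).image F := by
      intro J' hJ'
      obtain ⟨hJ'S, v, hvJ, hvJ'⟩ := Finset.mem_filter.1 hJ'
      obtain ⟨⟨hJ'B, hJ'r⟩, y, hy, y', hy', hyy, hdiv⟩ := (hmemS J').1 hJ'S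
      wlog hy'v : y' ≠ v generalizing y y'
      · push Not at hy'v
        exact this y' hy' y hy hyy.symm hdiv.symm (by rw [← hy'v]; exact hyy)
      have hy'e : y' ∈ J'.erase v := Finset.mem_erase.2 ⟨hy'v, hy'⟩
      set Q := (J'.erase v).erase y' with hQ
      have hQc : Q.card = r - 2 := by
        rw [hQ, Finset.card_erase_of_mem hy'e, Finset.card_erase_of_mem hvJ', hJ'r]; omega
      let en := (Q.equivFinOfCardEq hQc).symm
      have hQB : ∀ q : Q, (q : ℕ) < B := fun q => Finset.mem_range.1
        (hJ'B (Finset.mem_of_mem_erase (Finset.mem_of_mem_erase q.2)))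
      have him : (Finset.univ.image fun k => (en k : ℕ)) = Q := by
        ext q
        simp only [Finset.mem_image, Finset.mem_univ, true_and]
        constructor
        · rintro ⟨k, rfl⟩
          exact (en k).2
        · intro hq
          exact ⟨en.symm ⟨q, hq⟩, by simp⟩
      have hz : ∃ z : Option (Fin (r - 2)), z.elim v (fun k => (en k : ℕ)) = y := by
        by_cases hyv : y = v
        · exact ⟨none, hyv.symm⟩
        · have hyQ : y ∈ Q := Finset.mem_erase.2 ⟨hyy, Finset.mem_erase.2 ⟨hyv, hy⟩⟩
          exact ⟨some (en.symm ⟨y, hyQ⟩), by simp⟩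
      obtain ⟨z, hz⟩ := hz
      rw [Finset.mem_image]
      refine ⟨(⟨v, hvJ⟩, (z, ⟨y' % D, Nat.mod_lt _ hD⟩), fun k => ⟨en k, hQB _⟩),
        Finset.mem_univ _, ?_⟩
      simp only [F, hz, him]
      rw [hdiv, Nat.div_add_mod', hQ, Finset.insert_erase hy'e, Finset.insert_erase hvJ']
    refine (Finset.card_le_card hsub).trans (Finset.card_image_le.trans ?_)
    rw [Finset.card_univ]
    simp only [X, Fintype.card_prod, Fintype.card_option, Fintype.card_fin, Fintype.card_coe,
      Fintype.card_fun, ((hmemS J).1 hJ).1.2]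
    rw [show r - 2 + 1 = r - 1 by omega, mul_assoc r]
  obtain ⟨κ, hκ⟩ := exists_greedy_coloring S (fun J J' => ∃ v ∈ J, v ∈ J')
    (fun J J' ⟨v, h, h'⟩ => ⟨v, h', h⟩) _ hdeg
  have hle : r * ((r - 1) * D) * B ^ (r - 2) + 1 ≤
      (r * ((r - 1) * D) + 1) * B ^ (r - 2) := by
    rw [add_mul, one_mul]
    exact Nat.add_le_add_left (Nat.one_le_pow _ _ hB) _
  refine ⟨fun J => Fin.castLE hle (κ J), fun J J' h1 h1' h2 h2' h3 h3' hc hv => ?_⟩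
  by_contra hne
  exact hκ J ((hmemS J).2 ⟨⟨h1, h2⟩, h3⟩) J' ((hmemS J').2 ⟨⟨h1', h2'⟩, h3'⟩) hne hv
    (Fin.castLE_injective hle hc)

/-! ### Blow-ups of bipartite graphs -/

namespace Hypergraph

/-- A hypergraph obtained by blowing up the vertices of a bipartite graph without `K_{a,b}` to
clusters of size less than `a + b` has no Berge copy of `K_{a,b}`. -/
lemma not_hasBergeBiclique_of_clusters {V Z C : Type*} {a b : ℕ} (ha : 2 ≤ a) (hb : 2 ≤ b)
    (𝓗 : Set (Finset V)) (side : V → Bool) (label : V → Z) (X : Finset V → Bool → Z)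
    (hX : ∀ e ∈ 𝓗, ∀ v ∈ e, label v = X e (side v))
    (hXinj : ∀ e ∈ 𝓗, ∀ e' ∈ 𝓗, X e = X e' → e = e')
    (hcluster : ∀ (σ : Bool) (z : Z) (Q : Finset V),
      (∀ v ∈ Q, (∃ e ∈ 𝓗, v ∈ e) ∧ side v = σ ∧ label v = z) → Q.card < a + b)
    (χ : Z → Z → C) (hχ : ∀ x y, χ x y = χ y x)
    (hfree : ∀ (u : Fin a → Z) (w : Fin b → Z) (c : C), Function.Injective u →
        Function.Injective w → ¬ ∀ i j, χ (u i) (w j) = c)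
    (c : C) (hc : ∀ e ∈ 𝓗, χ (X e false) (X e true) = c) : ¬ HasBergeBiclique a b 𝓗 := by
  classical
  rintro ⟨u, w, E, hE, hmem⟩
  let i₀ : Fin a := ⟨0, by omega⟩
  let i₁ : Fin a := ⟨1, by omega⟩
  let j₀ : Fin b := ⟨0, by omega⟩
  let j₁ : Fin b := ⟨1, by omega⟩
  have hi : i₀ ≠ i₁ := by simp [i₀, i₁]
  have hj : j₀ ≠ j₁ := by simp [j₀, j₁]
  have hu : ∀ i j, label (u i) = X (E i j) (side (u i)) := fun i j =>
    hX _ (hmem i j) _ (hE.left_mem i j)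
  have hw : ∀ i j, label (w j) = X (E i j) (side (w j)) := fun i j =>
    hX _ (hmem i j) _ (hE.right_mem i j)
  have hsame : ∀ i j, side (u i) = side (w j) → label (u i) = label (w j) := fun i j h => by
    rw [hu i j, hw i j, h]
  have hedge : ∀ i j i' j' (σ : Bool), X (E i j) σ = X (E i' j') σ →
      X (E i j) (!σ) = X (E i' j') (!σ) → i = i' ∧ j = j' := by
    intro i j i' j' σ h1 h2
    refine hE.edge_inj _ _ _ _ (hXinj _ (hmem i j) _ (hmem i' j') (funext fun τ => ?_))
    obtain rfl | rfl : τ = σ ∨ τ = !σ := by cases τ <;> cases σ <;> simp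
    · exact h1
    · exact h2
  have hopp : ∀ σ τ : Bool, σ ≠ τ → τ = !σ := by decide
  have hall : ∀ σ z, ¬ ((∀ i, side (u i) = σ ∧ label (u i) = z) ∧
      ∀ j, side (w j) = σ ∧ label (w j) = z) := by
    rintro σ z ⟨h1, h2⟩
    have hinj : Function.Injective (Sum.elim u w) := by
      rintro (x | x) (y | y) hxy
      · rw [hE.injective_left hxy]
      · exact absurd hxy (hE.left_ne_right x y)
      · exact absurd hxy.symm (hE.left_ne_right y x)
      · rw [hE.injective_right hxy]
    have := hcluster σ z (Finset.univ.image (Sum.elim u w)) (by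
      intro v hv
      obtain ⟨x | x, -, rfl⟩ := Finset.mem_image.1 hv
      · exact ⟨⟨_, hmem x j₀, hE.left_mem _ _⟩, h1 x⟩
      · exact ⟨⟨_, hmem i₀ x, hE.right_mem _ _⟩, h2 x⟩)
    rw [Finset.card_image_of_injective _ hinj] at this
    simp at this
  -- If `w j` lay on the other side, the edges `E i j` and `E i' j` would agree in both labels and
  -- coincide.
  have huu : ∀ i i' j, i ≠ i' → side (u i) = side (u i') → label (u i) = label (u i') →
      side (w j) = side (u i) := by
    intro i i' j hii hs hl
    by_contra h
    have hτ := hopp _ _ (Ne.symm h)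
    refine hii (hedge i j i' j (side (u i)) ?_ ?_).1
    · rw [← hu i j, hs, ← hu i' j, hl]
    · rw [← hτ, ← hw i j, ← hw i' j]
  have hww : ∀ i j j', j ≠ j' → side (w j) = side (w j') → label (w j) = label (w j') →
      side (u i) = side (w j) := by
    intro i j j' hjj hs hl
    by_contra h
    have hτ := hopp _ _ (Ne.symm h)
    refine hjj (hedge i j i j' (side (w j)) ?_ ?_).2
    · rw [← hw i j, hs, ← hw i j', hl]
    · rw [← hτ, ← hu i j, ← hu i j']
  -- Two `u`'s in one cluster pull in every `w`, and two `w`'s then pull in every `u`, overfilling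
  -- the cluster.
  have hu_inj : ∀ i i', side (u i) = side (u i') → label (u i) = label (u i') → i = i' := by
    intro i i' hs hl
    by_contra hii
    have h1 : ∀ j, side (w j) = side (u i) ∧ label (w j) = label (u i) := fun j =>
      ⟨huu i i' j hii hs hl, (hsame i j (huu i i' j hii hs hl).symm).symm⟩
    have h2 : ∀ k, side (u k) = side (u i) ∧ label (u k) = label (u i) := fun k => by
      have h := hww k j₀ j₁ hj ((h1 j₀).1.trans (h1 j₁).1.symm) ((h1 j₀).2.trans (h1 j₁).2.symm)
      exact ⟨h.trans (h1 j₀).1, (hsame k j₀ h).trans (h1 j₀).2⟩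
    exact hall _ _ ⟨h2, h1⟩
  have hw_inj : ∀ j j', side (w j) = side (w j') → label (w j) = label (w j') → j = j' := by
    intro j j' hs hl
    by_contra hjj
    have h1 : ∀ i, side (u i) = side (w j) ∧ label (u i) = label (w j) := fun i =>
      ⟨hww i j j' hjj hs hl, hsame i j (hww i j j' hjj hs hl)⟩
    exact hi (hu_inj _ _ ((h1 i₀).1.trans (h1 i₁).1.symm) ((h1 i₀).2.trans (h1 i₁).2.symm))
  -- If `u i` and `w j` share a cluster, any other `u i'` and `w j'` share one on the opposite side,
  -- so `E i' j` and `E i j'` have the same labels.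
  have hne : ∀ i j, side (u i) ≠ side (w j) := by
    intro i j hs
    have hl := hsame i j hs
    obtain ⟨i', hi'⟩ : ∃ i', i' ≠ i := by
      by_cases h : i = i₀
      · exact ⟨i₁, h ▸ hi.symm⟩
      · exact ⟨i₀, fun h' => h h'.symm⟩
    obtain ⟨j', hj'⟩ : ∃ j', j' ≠ j := by
      by_cases h : j = j₀
      · exact ⟨j₁, h ▸ hj.symm⟩
      · exact ⟨j₀, fun h' => h h'.symm⟩
    have h1 : side (u i') ≠ side (w j) := fun h =>
      hi' (hu_inj _ _ (h.trans hs.symm) ((hsame _ _ h).trans hl.symm))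
    have h2 : side (w j') ≠ side (u i) := fun h =>
      hj' (hw_inj _ _ (h.trans hs) ((hsame _ _ h.symm).symm.trans hl))
    have h3 : side (u i') = side (w j') := by
      rw [hopp _ _ h1.symm, hopp _ _ h2.symm, hs]
    have h4 := hsame _ _ h3
    refine hi' (hedge i' j i j' (side (w j)) ?_ ?_).1
    · rw [← hw i' j, ← hs, ← hu i j', hl]
    · rw [← hopp _ _ h1.symm, ← hu i' j, h3, ← hw i j', h4]
  have hside : ∀ i, side (u i) = side (u i₀) := fun i => by
    have h1 := hopp _ _ (hne i j₀).symm
    have h2 := hopp _ _ (hne i₀ j₀).symm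
    rw [h1, h2]
  have hside' : ∀ j, side (w j) = !side (u i₀) := fun j => hopp _ _ (hne i₀ j)
  refine hfree (fun i => label (u i)) (fun j => label (w j)) c
    (fun i i' h => hu_inj i i' ((hside i).trans (hside i').symm) h)
    (fun j j' h => hw_inj j j' ((hside' j).trans (hside' j').symm) h) fun i j => ?_
  have h1 := hu i j
  have h2 := hw i j
  rw [hside] at h1
  rw [hside'] at h2
  simp only [h1, h2]
  cases side (u i₀)
  · exact hc _ (hmem i j)
  · rw [hχ]
    exact hc _ (hmem i j)

end Hypergraph

/-! ### The multiscale colouring of `r`-sets -/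

/-- The elements of an `r`-element set of naturals in increasing order. -/
noncomputable def sortedElem (r : ℕ) (e : Finset ℕ) (i : Fin r) : ℕ :=
  if h : e.card = r then e.orderEmbOfFin h i else 0

lemma sortedElem_mem {r : ℕ} {e : Finset ℕ} (h : e.card = r) (i : Fin r) :
    sortedElem r e i ∈ e := by
  rw [sortedElem, dif_pos h]
  exact Finset.orderEmbOfFin_mem _ _ _

lemma sortedElem_strictMono {r : ℕ} {e : Finset ℕ} (h : e.card = r) :
    StrictMono (sortedElem r e) := by
  intro i j hij
  rw [sortedElem, sortedElem, dif_pos h, dif_pos h]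
  exact (e.orderEmbOfFin h).strictMono hij

lemma exists_sortedElem_eq {r : ℕ} {e : Finset ℕ} (h : e.card = r) {v : ℕ} (hv : v ∈ e) :
    ∃ i, sortedElem r e i = v := by
  have : v ∈ Set.range (e.orderEmbOfFin h) := by rwa [Finset.range_orderEmbOfFin]
  obtain ⟨i, hi⟩ := this
  exact ⟨i, by rw [sortedElem, dif_pos h, hi]⟩

lemma sortedElem_div {r N : ℕ} {e : Finset ℕ} (h : e.card = r)
    (hinj : Set.InjOn (· / N) (e : Set ℕ)) (i : Fin r) :
    sortedElem r e i / N = sortedElem r (e.image (· / N)) i := by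
  have hc : (e.image (· / N)).card = r := by rw [Finset.card_image_of_injOn hinj, h]
  have hm : StrictMono fun i => sortedElem r e i / N := by
    intro i j hij
    refine lt_of_le_of_ne (Nat.div_le_div_right (sortedElem_strictMono h hij).le) fun heq => ?_
    exact (sortedElem_strictMono h hij).ne
      (hinj (sortedElem_mem h i) (sortedElem_mem h j) heq)
  have := Finset.orderEmbOfFin_unique hc
    (fun i => Finset.mem_image_of_mem (· / N) (sortedElem_mem h i)) hm
  have hR : sortedElem r (e.image (· / N)) i = (e.image (· / N)).orderEmbOfFin hc i := dif_pos hc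
  rw [hR, ← this]

namespace Hypergraph

/-- The hyperedges that meet each block of length `N` at most once, and whose first `h` elements,
and whose remaining elements, are translates of fixed patterns within the blocks of `J`, contain no
Berge copy of `K_{a,b}` when the translation vectors do not. -/
lemma not_hasBergeBiclique_of_blocks {a b r h N : ℕ} {C : Type*} (ha : 2 ≤ a) (hb : 2 ≤ b)
    (hh : 0 < h) (hhr : h < r) (hh1 : h < a + b) (hh2 : r - h < a + b) (hN : N ≠ 0)
    (χ : ZMod N → ZMod N → C) (hχ : ∀ x y, χ x y = χ y x)
    (hfree : ∀ (u : Fin a → ZMod N) (w : Fin b → ZMod N) (c : C), Function.Injective u →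
        Function.Injective w → ¬ ∀ i j, χ (u i) (w j) = c)
    (c : C) (δ : Fin r → ZMod N) (𝓗 : Set (Finset ℕ)) (hcard : ∀ e ∈ 𝓗, e.card = r)
    (hinj : ∀ e ∈ 𝓗, Set.InjOn (· / N) (e : Set ℕ))
    (hdisj : ∀ e ∈ 𝓗, ∀ e' ∈ 𝓗, (∃ v ∈ e, v ∈ e') → e.image (· / N) = e'.image (· / N))
    (hδ : ∀ e ∈ 𝓗, ∀ i : Fin r, (sortedElem r e i : ZMod N) =
      δ i + (if (i : ℕ) < h then (sortedElem r e ⟨0, by omega⟩ : ZMod N)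
        else (sortedElem r e ⟨h, hhr⟩ : ZMod N)))
    (hc : ∀ e ∈ 𝓗, χ (sortedElem r e ⟨0, by omega⟩) (sortedElem r e ⟨h, hhr⟩) = c) :
    ¬ HasBergeBiclique a b 𝓗 := by
  classical
  rintro ⟨u, w, E, hE, hmem⟩
  let i₀ : Fin a := ⟨0, by omega⟩
  let j₀ : Fin b := ⟨0, by omega⟩
  set J := (E i₀ j₀).image (· / N) with hJ
  -- Go from `E i j` through `u i` to `E i j₀`, then through `w j₀` to `E i₀ j₀`.
  have hEJ : ∀ i j, (E i j).image (· / N) = J := fun i j =>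
    (hdisj _ (hmem i j) _ (hmem i j₀) ⟨_, hE.left_mem i j, hE.left_mem i j₀⟩).trans
      (hdisj _ (hmem i j₀) _ (hmem i₀ j₀) ⟨_, hE.right_mem i j₀, hE.right_mem i₀ j₀⟩)
  have hJc : J.card = r := by
    rw [hJ, Finset.card_image_of_injOn (hinj _ (hmem _ _)), hcard _ (hmem _ _)]
  have : Nonempty (Fin r) := ⟨⟨h, hhr⟩⟩
  have : NeZero N := ⟨hN⟩
  let pos : ℕ → Fin r := fun v => Function.invFun (sortedElem r J) (v / N)
  have hpos : ∀ e ∈ 𝓗, e.image (· / N) = J → ∀ i, pos (sortedElem r e i) = i := by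
    intro e he heJ i
    simp only [pos]
    rw [sortedElem_div (hcard e he) (hinj e he), heJ]
    exact Function.leftInverse_invFun (sortedElem_strictMono hJc).injective i
  have hdet : ∀ x y : ℕ, x / N = y / N → (x : ZMod N) = y → x = y := by
    intro x y h1 h2
    rw [ZMod.natCast_eq_natCast_iff'] at h2
    rw [← Nat.div_add_mod x N, h1, h2, Nat.div_add_mod]
  -- The rank of the block of `v` in `J` gives its side, and removing the shift of that rank gives
  -- the base residue as label. A cluster has at most one vertex per rank, hence at most `h` or `r -
  -- h`.
  refine not_hasBergeBiclique_of_clusters (Z := ZMod N) ha hb {e ∈ 𝓗 | e.image (· / N) = J}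
    (fun v => decide (h ≤ (pos v : ℕ))) (fun v => (v : ZMod N) - δ (pos v))
    (fun e σ => if σ then (sortedElem r e ⟨h, hhr⟩ : ZMod N)
      else (sortedElem r e ⟨0, by omega⟩ : ZMod N)) ?_ ?_ ?_ χ hχ hfree c ?_
    ⟨u, w, E, hE, fun i j => ⟨hmem i j, hEJ i j⟩⟩
  · rintro e ⟨he, heJ⟩ v hv
    obtain ⟨i, rfl⟩ := exists_sortedElem_eq (hcard e he) hv
    simp only [hpos e he heJ, decide_eq_true_eq]
    rw [hδ e he i]
    by_cases hi : (i : ℕ) < h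
    · rw [if_pos hi, if_neg (by omega)]; ring
    · rw [if_neg hi, if_pos (by omega)]; ring
  · rintro e ⟨he, heJ⟩ e' ⟨he', heJ'⟩ hee
    have h0 := congrFun hee false
    have h1 := congrFun hee true
    simp only [if_true, Bool.false_eq_true, if_false] at h0 h1
    have hall : ∀ i, sortedElem r e i = sortedElem r e' i := by
      intro i
      refine hdet _ _ ?_ ?_
      · rw [sortedElem_div (hcard e he) (hinj e he), heJ,
          sortedElem_div (hcard e' he') (hinj e' he'), heJ']
      · rw [hδ e he i, hδ e' he' i, h0, h1]
    ext v
    constructor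
    · intro hv
      obtain ⟨i, rfl⟩ := exists_sortedElem_eq (hcard e he) hv
      rw [hall]; exact sortedElem_mem (hcard e' he') i
    · intro hv
      obtain ⟨i, rfl⟩ := exists_sortedElem_eq (hcard e' he') hv
      rw [← hall]; exact sortedElem_mem (hcard e he) i
  · intro σ z Q hQ
    have hposinj : Set.InjOn pos (Q : Set ℕ) := by
      intro x hx y hy hxy
      obtain ⟨⟨e, ⟨he, heJ⟩, hxe⟩, -, hxl⟩ := hQ x hx
      obtain ⟨⟨e', ⟨he', heJ'⟩, hye⟩, -, hyl⟩ := hQ y hy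
      refine hdet _ _ ?_ ?_
      · obtain ⟨i, rfl⟩ := exists_sortedElem_eq (hcard e he) hxe
        obtain ⟨j, rfl⟩ := exists_sortedElem_eq (hcard e' he') hye
        rw [hpos e he heJ, hpos e' he' heJ'] at hxy
        rw [sortedElem_div (hcard e he) (hinj e he), heJ,
          sortedElem_div (hcard e' he') (hinj e' he'), heJ', hxy]
      · rw [hxy, ← hyl] at hxl
        exact sub_left_injective hxl
    have hcardpos : ∀ T : Finset ℕ, (∀ v ∈ Q, (pos v : ℕ) ∈ T) → Q.card ≤ T.card := by
      intro T hT
      refine Finset.card_le_card_of_injOn (fun v => (pos v : ℕ)) hT ?_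
      exact fun x hx y hy hxy => hposinj hx hy (Fin.ext hxy)
    cases σ
    · have := hcardpos (Finset.range h) fun v hv => by
        have := (hQ v hv).2.1
        simpa using this
      rw [Finset.card_range] at this
      omega
    · have := hcardpos (Finset.Ico h r) fun v hv => by
        have := (hQ v hv).2.1
        rw [Finset.mem_Ico]
        exact ⟨by simpa using this, (pos v).2⟩
      rw [Nat.card_Ico] at this
      omega
  · rintro e ⟨he, -⟩
    simpa using hc e he

/-- There is a colouring of the `r`-subsets of `{0, …, 2 ^ (b * L) - 1}` with few colours and no
monochromatic Berge copy of `K_{a,b}`. -/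
theorem exists_coloring_not_hasBergeBiclique {a b r : ℕ} (hb : 2 ≤ b) (ha : (b - 1)! < a)
    (hr₂ : 2 ≤ r) (hr : r < 2 * (a + b) - 1) :
    ∃ C : ℕ, 0 < C ∧ ∀ L : ℕ, ∃ κ : Finset ℕ → Fin (C * (2 * (2 ^ b) ^ (r - 2)) ^ L),
      ∀ c, ¬ HasBergeBiclique a b
        {e | e ⊆ Finset.range ((2 ^ b) ^ L) ∧ e.card = r ∧ κ e = c} := by
  classical
  have ha2 : 2 ≤ a := by
    have := Nat.factorial_pos (b - 1)
    omega
  set D := 2 ^ b with hD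
  have hDpos : 0 < D := by positivity
  set C₀ := r * ((r - 1) * D) + 1 with hC₀
  refine ⟨C₀ * 8, by positivity, fun L => ?_⟩
  -- Both halves have fewer than `a + b` ranks exactly because `r ≤ 2 * (a + b) - 2`.
  set h := (r + 1) / 2 with hh
  have hh0 : 0 < h := by omega
  have hhr : h < r := by omega
  let i₀ : Fin r := ⟨0, by omega⟩
  let ih : Fin r := ⟨h, hhr⟩
  have hi : i₀ ≠ ih := by simp [i₀, ih, Fin.ext_iff]; omega
  have hNe : ∀ s, NeZero (D ^ s) := fun s => ⟨(pow_pos hDpos s).ne'⟩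
  choose χ hχ hfree using fun s : ℕ => exists_coloring_biclique_free hb ha s (ZMod (D ^ s))
    (ZMod.card _)
  choose γ hγ using fun s : ℕ => exists_coloring_disjoint r D (D ^ (L - s)) hr₂ hDpos
    (pow_pos hDpos _)
  let I := {i : Fin r // i ≠ i₀ ∧ i ≠ ih}
  let T : Fin (L + 1) → Type := fun s => Fin (C₀ * (D ^ (L - (s : ℕ))) ^ (r - 2)) ×
    (I → ZMod (D ^ (s : ℕ))) × Fin (2 ^ ((s : ℕ) + 2))
  let scale : Finset ℕ → ℕ := fun e =>
    Nat.findGreatest (fun s => Set.InjOn (· / D ^ s) (e : Set ℕ)) L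
  let base : (s : ℕ) → Finset ℕ → Fin r → ZMod (D ^ s) := fun s e i =>
    if (i : ℕ) < h then (sortedElem r e i₀ : ZMod (D ^ s)) else (sortedElem r e ih : ZMod (D ^ s))
  let col : (s : Fin (L + 1)) → Finset ℕ → T s := fun s e =>
    (γ s (e.image (· / D ^ (s : ℕ))),
      fun i => (sortedElem r e i : ZMod (D ^ (s : ℕ))) - base s e i,
      χ s (sortedElem r e i₀) (sortedElem r e ih))
  have hscale : ∀ e, scale e < L + 1 := fun e => Nat.lt_succ_of_le (Nat.findGreatest_le L)
  let color : Finset ℕ → Σ s, T s := fun e => ⟨⟨scale e, hscale e⟩, col _ e⟩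
  have hIcard : Fintype.card I = r - 2 := by
    have : Fintype.card I = (({i₀, ih} : Finset (Fin r))ᶜ).card := by
      rw [Fintype.card_subtype]
      congr 1
      ext i
      simp
    rw [this, Finset.card_compl, Fintype.card_fin, Finset.card_pair hi]
  have hcard : Fintype.card (Σ s, T s) ≤ C₀ * 8 * (2 * D ^ (r - 2)) ^ L := by
    have hT : ∀ s : Fin (L + 1), Fintype.card (T s) =
        C₀ * 4 * (D ^ (r - 2)) ^ L * 2 ^ (s : ℕ) := by
      intro s
      have hs : L - (s : ℕ) + s = L := by have := s.2; omega
      simp only [T, Fintype.card_prod, Fintype.card_fin, Fintype.card_fun, ZMod.card, hIcard]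
      have hpow : (D ^ (L - (s : ℕ))) ^ (r - 2) * (D ^ (s : ℕ)) ^ (r - 2) = (D ^ (r - 2)) ^ L := by
        rw [← mul_pow, ← pow_add, hs, pow_right_comm]
      rw [← hpow, pow_add]
      ring
    rw [Fintype.card_sigma, Finset.sum_congr rfl fun s _ => hT s, ← Finset.mul_sum,
      Fin.sum_univ_eq_sum_range (fun i => 2 ^ i), Nat.geomSum_eq le_rfl]
    simp only [Nat.add_one_sub_one, Nat.div_one]
    calc C₀ * 4 * (D ^ (r - 2)) ^ L * (2 ^ (L + 1) - 1)
        ≤ C₀ * 4 * (D ^ (r - 2)) ^ L * 2 ^ (L + 1) := Nat.mul_le_mul_left _ (Nat.sub_le _ _)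
      _ = _ := by rw [mul_pow]; ring
  obtain ⟨g⟩ := Function.Embedding.nonempty_of_card_le
    (α := Σ s, T s) (β := Fin (C₀ * 8 * (2 * D ^ (r - 2)) ^ L)) (by simpa using hcard)
  refine ⟨fun e => g (color e), fun c hbad => ?_⟩
  obtain ⟨⟨s, τ⟩, hτ⟩ : ∃ τ, ∀ e, g (color e) = c → color e = τ := by
    obtain ⟨u, w, E, hE, hmem⟩ := hbad
    refine ⟨color (E ⟨0, by omega⟩ ⟨0, by omega⟩), fun e he => g.injective ?_⟩
    exact he.trans (hmem _ _).2.2.symm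
  have hcol : ∀ e, color e = ⟨s, τ⟩ → scale e = s ∧ col s e = τ := by
    intro e he
    simp only [color] at he
    cases he
    exact ⟨rfl, rfl⟩
  obtain ⟨τγ, τδ, τχ⟩ := τ
  have hprop : ∀ e, e ⊆ Finset.range (D ^ L) ∧ e.card = r ∧ g (color e) = c →
      e.card = r ∧ Set.InjOn (· / D ^ (s : ℕ)) (e : Set ℕ) ∧
      e.image (· / D ^ (s : ℕ)) ⊆ Finset.range (D ^ (L - (s : ℕ))) ∧
      (∃ y ∈ e.image (· / D ^ (s : ℕ)), ∃ y' ∈ e.image (· / D ^ (s : ℕ)),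
        y ≠ y' ∧ y / D = y' / D) ∧ col s e = (τγ, τδ, τχ) := by
    rintro e ⟨heL, her, hec⟩
    obtain ⟨h1, h2⟩ := hcol e (hτ e hec)
    have hinj : Set.InjOn (· / D ^ (s : ℕ)) (e : Set ℕ) := by
      rw [← h1]
      exact Nat.findGreatest_spec (P := fun s => Set.InjOn (· / D ^ s) (e : Set ℕ))
        (Nat.zero_le L) (by simp)
    have hsL : (s : ℕ) ≤ L := Nat.lt_succ_iff.1 s.2
    have hlt : ∀ v ∈ e, v < D ^ L := fun v hv => Finset.mem_range.1 (heL hv)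
    refine ⟨her, hinj, ?_, ?_, h2⟩
    · intro y hy
      obtain ⟨v, hv, rfl⟩ := Finset.mem_image.1 hy
      rw [Finset.mem_range, Nat.div_lt_iff_lt_mul (pow_pos hDpos _), ← pow_add,
        Nat.sub_add_cancel hsL]
      exact hlt v hv
    · have hnot : ¬ Set.InjOn (· / D ^ ((s : ℕ) + 1)) (e : Set ℕ) := by
        obtain hs | hs := hsL.lt_or_eq
        · refine Nat.findGreatest_is_greatest (P := fun s => Set.InjOn (· / D ^ s) (e : Set ℕ))
            (n := L) ?_ hs
          change scale e < _
          omega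
        · intro hinj'
          obtain ⟨x, hx, y, hy, hxy⟩ := Finset.one_lt_card.1 (by omega : 1 < e.card)
          have hz : ∀ v ∈ e, v / D ^ ((s : ℕ) + 1) = 0 := fun v hv => by
            refine Nat.div_eq_of_lt ((hlt v hv).trans_le ?_)
            exact Nat.pow_le_pow_right hDpos (by omega)
          exact hxy (hinj' hx hy ((hz x hx).trans (hz y hy).symm))
      simp only [Set.InjOn, not_forall] at hnot
      obtain ⟨x, hx, y, hy, hxy, hne⟩ := hnot
      refine ⟨_, Finset.mem_image_of_mem _ hx, _, Finset.mem_image_of_mem _ hy,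
        fun heq => hne (hinj hx hy heq), ?_⟩
      rw [Nat.div_div_eq_div_mul, Nat.div_div_eq_div_mul, ← pow_succ]
      exact hxy
  have : NeZero (D ^ (s : ℕ)) := hNe s
  refine not_hasBergeBiclique_of_blocks ha2 hb hh0 hhr (by omega) (by omega)
    (pow_pos hDpos _).ne' (χ s) (hχ s) (hfree s) τχ
    (fun i => if hi : i ≠ i₀ ∧ i ≠ ih then τδ ⟨i, hi⟩ else 0) _ (fun e he => (hprop e he).1)
    (fun e he => (hprop e he).2.1) ?_ ?_ ?_ hbad
  · rintro e he e' he' ⟨v, hv, hv'⟩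
    obtain ⟨h1, h2, h3, h4, h5⟩ := hprop e he
    obtain ⟨h1', h2', h3', h4', h5'⟩ := hprop e' he'
    refine hγ s _ _ h3 h3' ?_ ?_ h4 h4' ?_
      ⟨_, Finset.mem_image_of_mem _ hv, Finset.mem_image_of_mem _ hv'⟩
    · rw [Finset.card_image_of_injOn h2, h1]
    · rw [Finset.card_image_of_injOn h2', h1']
    · exact (congrArg Prod.fst h5).trans (congrArg Prod.fst h5').symm
  · intro e he i
    obtain ⟨h1, h2, h3, h4, h5⟩ := hprop e he
    by_cases hi' : i ≠ i₀ ∧ i ≠ ih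
    · rw [dif_pos hi']
      have h6 := congrFun (congrArg (fun x => x.2.1) h5) ⟨i, hi'⟩
      simp only [col, base] at h6
      rw [← h6]
      exact (sub_add_cancel _ _).symm
    · rw [dif_neg hi', zero_add]
      obtain rfl | rfl : i = i₀ ∨ i = ih := by tauto
      · rw [if_pos (by simpa [i₀] using hh0)]
      · rw [if_neg (by simp [ih])]
  · intro e he
    exact congrArg (fun x => x.2.2) (hprop e he).2.2.2.2

/-- Below the threshold given by the colouring, the Ramsey property fails. -/
theorem exists_not_isRamsey {a b r : ℕ} (hb : 2 ≤ b) (ha : (b - 1)! < a)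
    (hr₂ : 2 ≤ r) (hr : r < 2 * (a + b) - 1) :
    ∃ C : ℕ, 0 < C ∧ ∀ L k n : ℕ, n ≤ (2 ^ b) ^ L → C * (2 * (2 ^ b) ^ (r - 2)) ^ L ≤ k →
      ¬ IsRamsey r (bergeFamily (completeBipartiteGraph (Fin a) (Fin b))) k n := by
  classical
  obtain ⟨C, hC, h⟩ := exists_coloring_not_hasBergeBiclique hb ha hr₂ hr
  refine ⟨C, hC, fun L k n hn hk hR => ?_⟩
  obtain ⟨κ, hκ⟩ := h L
  obtain ⟨i, u, w, E, hE, hmem⟩ := hR.hasBergeBiclique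
    fun e => Fin.castLE hk (κ (e.map Fin.valEmbedding))
  have ha0 : 0 < a := by omega
  refine hκ (κ ((E ⟨0, ha0⟩ ⟨0, by omega⟩).map Fin.valEmbedding))
    ⟨fun i => (u i : ℕ), fun j => (w j : ℕ), fun i j => (E i j).map Fin.valEmbedding,
    ⟨fun x y hxy => hE.injective_left (Fin.ext hxy), fun x y hxy => hE.injective_right (Fin.ext hxy),
      fun i j hij => hE.left_ne_right i j (Fin.ext hij),
      fun i j i' j' hij => hE.edge_inj _ _ _ _ (Finset.map_injective _ hij),
      fun i j => Finset.mem_map_of_mem _ (hE.left_mem i j),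
      fun i j => Finset.mem_map_of_mem _ (hE.right_mem i j)⟩, fun i j => ⟨?_, ?_, ?_⟩⟩
  · intro v hv
    obtain ⟨x, -, rfl⟩ := Finset.mem_map.1 hv
    exact Finset.mem_range.2 (x.2.trans_le hn)
  · rw [Finset.card_map, (hmem i j).1]
  · exact Fin.castLE_injective hk ((hmem i j).2.trans (hmem _ _).2.symm)

end Hypergraph

/-! ### The Kővári–Sós–Turán bound -/

section Zarankiewicz

variable {V : Type*} [Fintype V]

/-- The graph `G` has no complete bipartite subgraph `K_{a,b}`. -/
def BicliqueFree (a b : ℕ) (G : SimpleGraph V) : Prop :=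
  ∀ (u : Fin a → V) (w : Fin b → V), Function.Injective u → Function.Injective w →
    ¬ ∀ i j, G.Adj (u i) (w j)

lemma BicliqueFree.card_common_lt {a b : ℕ} {G : SimpleGraph V} [DecidableRel G.Adj]
    (hG : BicliqueFree a b G) (w : Fin b → V) (hw : Function.Injective w) :
    (Finset.univ.filter fun v => ∀ j, G.Adj v (w j)).card < a := by
  by_contra! h
  obtain ⟨Q, hQ, hQc⟩ := Finset.exists_subset_card_eq h
  refine hG (fun i => ((Q.equivFinOfCardEq hQc).symm i : V)) w
    (Subtype.val_injective.comp (Equiv.injective _)) hw fun i j => ?_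
  exact (Finset.mem_filter.1 (hQ ((Q.equivFinOfCardEq hQc).symm i).2)).2 j

/-- Double counting of a vertex with an injective `b`-tuple of its neighbours: each tuple has fewer
than `a` common neighbours. -/
lemma BicliqueFree.sum_descFactorial_le {a b : ℕ} {G : SimpleGraph V} [DecidableRel G.Adj]
    (hG : BicliqueFree a b G) :
    ∑ v, (G.degree v).descFactorial b ≤ a * Fintype.card V ^ b := by
  have h1 : ∀ v, (G.degree v).descFactorial b ≤
      (Finset.univ.filter fun w : Fin b ↪ V => ∀ j, G.Adj v (w j)).card := by
    intro v
    have h : (G.degree v).descFactorial b = Fintype.card (Fin b ↪ G.neighborSet v) := by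
      rw [Fintype.card_embedding_eq, Fintype.card_fin, SimpleGraph.card_neighborSet_eq_degree]
    rw [h, ← Finset.card_univ]
    refine Finset.card_le_card_of_injOn (fun w => w.trans (Function.Embedding.subtype _)) ?_ ?_
    · intro w _
      simp only [Finset.coe_filter, Finset.mem_univ, true_and, Set.mem_ofPred_eq]
      exact fun j => (w j).2
    · intro w _ w' _ hww
      ext j
      exact congrArg (fun e : Fin b ↪ V => e j) hww
  calc ∑ v, (G.degree v).descFactorial b
      ≤ ∑ v, (Finset.univ.filter fun w : Fin b ↪ V => ∀ j, G.Adj v (w j)).card :=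
        Finset.sum_le_sum fun v _ => h1 v
    _ = ∑ w : Fin b ↪ V, (Finset.univ.filter fun v => ∀ j, G.Adj v (w j)).card :=
        Finset.sum_card_bipartiteAbove_eq_sum_card_bipartiteBelow
          (fun (v : V) (w : Fin b ↪ V) => ∀ j, G.Adj v (w j))
    _ ≤ ∑ _w : Fin b ↪ V, a := Finset.sum_le_sum fun w _ => (hG.card_common_lt w w.injective).le
    _ ≤ a * Fintype.card V ^ b := by
      rw [Finset.sum_const, Finset.card_univ, Fintype.card_embedding_eq, Fintype.card_fin,
        smul_eq_mul, mul_comm]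
      exact Nat.mul_le_mul_left _ (Nat.descFactorial_le_pow _ _)

/-- The Kővári–Sós–Turán bound. -/
theorem BicliqueFree.card_edgeFinset_le {a b : ℕ} (ha : 0 < a) (hb : 0 < b) {G : SimpleGraph V}
    [DecidableRel G.Adj] (hG : BicliqueFree a b G) :
    (G.edgeFinset.card : ℝ) ≤ (a + b) * (Fintype.card V : ℝ) ^ (2 - 1 / (b : ℝ)) := by
  obtain hV | hV := Nat.eq_zero_or_pos (Fintype.card V)
  · have : IsEmpty V := Fintype.card_eq_zero_iff.1 hV
    have : G.edgeFinset = ∅ := by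
      ext e
      induction e using Sym2.ind with
      | _ x y => exact isEmptyElim x
    rw [this, Finset.card_empty, Nat.cast_zero]
    positivity
  set n := Fintype.card V with hn
  have hn1 : (1 : ℝ) ≤ n := by exact_mod_cast hV
  have hb1 : (1 : ℝ) ≤ b := by exact_mod_cast hb
  have hb0 : (0 : ℝ) < b := by linarith
  obtain ⟨d, rfl⟩ : ∃ d, b = d + 1 := ⟨b - 1, by omega⟩
  -- The truncated `degree - b + 1`: its `b`-th power is below the falling factorial, so the power
  -- mean inequality applies. At most `b` is lost per vertex, which `n ≤ n ^ (2 - 1 / b)` absorbs.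
  set f : V → ℝ := fun v => ((G.degree v + 1 - (d + 1) : ℕ) : ℝ) with hf
  have hf0 : ∀ v ∈ (Finset.univ : Finset V), 0 ≤ f v := fun v _ => Nat.cast_nonneg _
  have hsum : ∑ v, f v ^ (d + 1) ≤ a * (n : ℝ) ^ (d + 1) := by
    have h1 : ∑ v, (G.degree v + 1 - (d + 1)) ^ (d + 1) ≤ a * n ^ (d + 1) :=
      (Finset.sum_le_sum fun v _ => Nat.pow_sub_le_descFactorial _ _).trans
        hG.sum_descFactorial_le
    simp only [hf]
    exact_mod_cast h1
  have hpow := pow_sum_div_card_le_sum_pow hf0 d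
  rw [Finset.card_univ, ← hn, div_le_iff₀ (by positivity)] at hpow
  have hF : ∑ v, f v ≤ a * (n : ℝ) ^ (2 - 1 / ((d + 1 : ℕ) : ℝ)) := by
    have hr : 0 ≤ a * (n : ℝ) ^ (2 - 1 / ((d + 1 : ℕ) : ℝ)) := by positivity
    refine le_of_pow_le_pow_left₀ (Nat.succ_ne_zero d) hr (hpow.trans ?_)
    have h2 : ((n : ℝ) ^ (2 - 1 / ((d + 1 : ℕ) : ℝ))) ^ (d + 1) = (n : ℝ) ^ (d + 1) * (n : ℝ) ^ d := by
      rw [← Real.rpow_natCast, ← Real.rpow_mul (by positivity), ← pow_add, ← Real.rpow_natCast]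
      congr 1
      rw [sub_mul, div_mul_cancel₀ _ hb0.ne']
      push_cast
      ring
    rw [mul_pow, h2, ← mul_assoc]
    have ha1 : (a : ℝ) ≤ (a : ℝ) ^ (d + 1) :=
      le_self_pow₀ (by exact_mod_cast ha) (Nat.succ_ne_zero d)
    calc (∑ v, f v ^ (d + 1)) * (n : ℝ) ^ d ≤ a * (n : ℝ) ^ (d + 1) * (n : ℝ) ^ d := by gcongr
      _ ≤ _ := by gcongr
  have hdeg : (G.edgeFinset.card : ℝ) ≤ ∑ v, (G.degree v : ℝ) := by
    have h := G.sum_degrees_eq_twice_card_edges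
    have h' : G.edgeFinset.card ≤ ∑ v, G.degree v := by omega
    exact_mod_cast h'
  have hn2 : (n : ℝ) ≤ (n : ℝ) ^ (2 - 1 / ((d + 1 : ℕ) : ℝ)) := by
    conv_lhs => rw [← Real.rpow_one (n : ℝ)]
    refine Real.rpow_le_rpow_of_exponent_le hn1 ?_
    have : 1 / ((d + 1 : ℕ) : ℝ) ≤ 1 := by
      rw [div_le_one hb0]; exact hb1
    linarith
  calc (G.edgeFinset.card : ℝ) ≤ ∑ v, (G.degree v : ℝ) := hdeg
    _ ≤ ∑ v, (f v + ((d + 1 : ℕ) : ℝ)) := by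
      refine Finset.sum_le_sum fun v _ => ?_
      simp only [hf]
      have : G.degree v ≤ (G.degree v + 1 - (d + 1)) + (d + 1) := by omega
      exact_mod_cast this
    _ = ∑ v, f v + n * ((d + 1 : ℕ) : ℝ) := by
      rw [Finset.sum_add_distrib, Finset.sum_const, Finset.card_univ, nsmul_eq_mul]
    _ ≤ a * (n : ℝ) ^ (2 - 1 / ((d + 1 : ℕ) : ℝ)) +
        (n : ℝ) ^ (2 - 1 / ((d + 1 : ℕ) : ℝ)) * ((d + 1 : ℕ) : ℝ) := by gcongr
    _ = _ := by ring

end Zarankiewicz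

/-! ### Families without a Berge biclique -/

namespace Hypergraph

variable {V : Type*} [Fintype V] [DecidableEq V] [Nonempty V]

/-- A maximal system of distinct representing pairs of a set family. -/
lemma exists_maximal_pairs (𝓗 : Finset (Finset V)) :
    ∃ 𝓢 ⊆ 𝓗, ∃ m : Finset V → Sym2 V, Set.InjOn m 𝓢 ∧
      (∀ S ∈ 𝓢, ¬ (m S).IsDiag ∧ ∀ x ∈ m S, x ∈ S) ∧
      ∀ S ∈ 𝓗 \ 𝓢, ∀ x ∈ S, ∀ y ∈ S, x ≠ y → ∃ T ∈ 𝓢, m T = s(x, y) := by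
  classical
  set 𝓐 : Finset (Finset (Finset V)) := 𝓗.powerset.filter fun 𝓢 => ∃ m : Finset V → Sym2 V, Set.InjOn m (𝓢 : Set (Finset V)) ∧
      ∀ S ∈ 𝓢, ¬ (m S).IsDiag ∧ ∀ x ∈ m S, x ∈ S with h𝓐
  have hne : 𝓐.Nonempty := by
    refine ⟨∅, Finset.mem_filter.2 ⟨Finset.empty_mem_powerset _,
      fun _ => s(Classical.arbitrary V, Classical.arbitrary V), by simp, by simp⟩⟩
  obtain ⟨𝓢, h𝓢, hmax⟩ := Finset.exists_max_image 𝓐 Finset.card hne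
  obtain ⟨hsub, m, hm, hmS⟩ := Finset.mem_filter.1 h𝓢
  rw [Finset.mem_powerset] at hsub
  refine ⟨𝓢, hsub, m, hm, hmS, fun S hS x hx y hy hxy => ?_⟩
  obtain ⟨hSH, hSS⟩ := Finset.mem_sdiff.1 hS
  by_contra! hno
  have hne' : ∀ T ∈ 𝓢, T ≠ S := fun T hT h => hSS (h ▸ hT)
  have hup : ∀ T ∈ 𝓢, Function.update m S s(x, y) T = m T := fun T hT =>
    Function.update_of_ne (hne' T hT) _ _
  have hmem : insert S 𝓢 ∈ 𝓐 := by
    refine Finset.mem_filter.2 ⟨Finset.mem_powerset.2 (Finset.insert_subset hSH hsub),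
      Function.update m S s(x, y), ?_, ?_⟩
    · intro T hT T' hT' hTT
      rw [Finset.mem_coe, Finset.mem_insert] at hT hT'
      obtain rfl | hT := hT <;> obtain rfl | hT' := hT'
      · rfl
      · rw [Function.update_self, hup _ hT'] at hTT
        exact absurd hTT.symm (hno _ hT')
      · rw [Function.update_self, hup _ hT] at hTT
        exact absurd hTT (hno _ hT)
      · rw [hup _ hT, hup _ hT'] at hTT
        exact hm hT hT' hTT
    · intro T hT
      rw [Finset.mem_insert] at hT
      obtain rfl | hT := hT
      · rw [Function.update_self]
        refine ⟨by simpa using hxy, fun z hz => ?_⟩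
        rw [Sym2.mem_iff] at hz
        obtain rfl | rfl := hz
        · exact hx
        · exact hy
      · rw [hup _ hT]
        exact hmS T hT
  have := hmax _ hmem
  rw [Finset.card_insert_of_notMem hSS] at this
  omega

/-- A uniform set family without a Berge copy of `K_{a,b}` has at most `(M + 1) * ex(n, K_{a,b})`
members, when every pair of vertices is in at most `M` cliques of a graph without `K_{a,b}`. -/
theorem card_le_of_not_hasBergeBiclique {a b r M : ℕ} (ha : 0 < a) (hb : 0 < b) (hr : 2 ≤ r)
    (hM : ∀ G : SimpleGraph V, BicliqueFree a b G → ∀ x y, x ≠ y → ∀ 𝓠 : Finset (Finset V),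
      (∀ S ∈ 𝓠, S.card = r ∧ x ∈ S ∧ y ∈ S ∧ ∀ v ∈ S, ∀ w ∈ S, v ≠ w → G.Adj v w) → 𝓠.card ≤ M)
    (𝓗 : Finset (Finset V)) (h𝓗 : ∀ S ∈ 𝓗, S.card = r)
    (hfree : ¬ HasBergeBiclique a b (𝓗 : Set (Finset V))) :
    (𝓗.card : ℝ) ≤ (M + 1) * ((a + b) * (Fintype.card V : ℝ) ^ (2 - 1 / (b : ℝ))) := by
  classical
  obtain ⟨𝓢, hsub, m, hm, hmS, hmax⟩ := exists_maximal_pairs 𝓗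
  let G : SimpleGraph V := SimpleGraph.fromEdgeSet (m '' 𝓢)
  have hadj : ∀ x y, G.Adj x y ↔ (∃ T ∈ 𝓢, m T = s(x, y)) ∧ x ≠ y := fun x y => by
    simp [G]
  -- A `K_{a,b}` in `G` lifts to a Berge copy: each edge is the pair of some set, and distinct edges
  -- come from distinct sets.
  have hG : BicliqueFree a b G := by
    intro u w hu hw h
    choose E hE hEm using fun i j => ((hadj _ _).1 (h i j)).1
    refine hfree ⟨u, w, E, ⟨hu, hw, fun i j => (h i j).ne, ?_, fun i j => ?_, fun i j => ?_⟩,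
      fun i j => hsub (hE i j)⟩
    · intro i j i' j' hee
      have h1 := hEm i j
      rw [hee, hEm i' j', Sym2.eq_iff] at h1
      obtain ⟨h2, h3⟩ | ⟨h2, h3⟩ := h1
      · exact ⟨(hu h2).symm, (hw h3).symm⟩
      · exact absurd h2 (h i' j).ne
    · exact (hmS _ (hE i j)).2 _ (by rw [hEm]; exact Sym2.mem_mk_left _ _)
    · exact (hmS _ (hE i j)).2 _ (by rw [hEm]; exact Sym2.mem_mk_right _ _)
  have hedge : G.edgeFinset = 𝓢.image m := by
    ext e
    rw [SimpleGraph.mem_edgeFinset, Finset.mem_image]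
    simp only [G, SimpleGraph.edgeSet_fromEdgeSet]
    constructor
    · rintro ⟨⟨T, hT, rfl⟩, -⟩
      exact ⟨T, hT, rfl⟩
    · rintro ⟨T, hT, rfl⟩
      exact ⟨⟨T, hT, rfl⟩, (hmS T hT).1⟩
  have hcardS : 𝓢.card = G.edgeFinset.card := by
    rw [hedge, Finset.card_image_of_injOn hm]
  have hpair : ∀ S : Finset V, ∃ e : Sym2 V, S ∈ 𝓗 \ 𝓢 →
      e ∈ G.edgeFinset ∧ ∃ x y, e = s(x, y) ∧ x ≠ y ∧ x ∈ S ∧ y ∈ S := by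
    intro S
    by_cases hS : S ∈ 𝓗 \ 𝓢
    · have hc := h𝓗 S (Finset.mem_sdiff.1 hS).1
      obtain ⟨x, hx, y, hy, hxy⟩ := Finset.one_lt_card.1 (by omega : 1 < S.card)
      refine ⟨s(x, y), fun _ => ⟨?_, x, y, rfl, hxy, hx, hy⟩⟩
      rw [SimpleGraph.mem_edgeFinset, SimpleGraph.mem_edgeSet, hadj]
      exact ⟨hmax S hS x hx y hy hxy, hxy⟩
    · have v := Classical.arbitrary V
      exact ⟨s(v, v), fun h => absurd h hS⟩
  choose q hq using hpair
  -- By maximality all pairs in an unrepresented set are edges of `G`. Assign to the set one such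
  -- edge; each edge is assigned at most `M` times.
  have hcardU : (𝓗 \ 𝓢).card ≤ M * G.edgeFinset.card := by
    have h1 : (𝓗 \ 𝓢).card ≤ M * ((𝓗 \ 𝓢).image q).card := by
      refine Finset.card_le_mul_card_image _ _ fun e he => ?_
      obtain ⟨S, hS, rfl⟩ := Finset.mem_image.1 he
      obtain ⟨-, x, y, hxy, hne, -, -⟩ := hq S hS
      refine hM G hG x y hne _ fun T hT => ?_
      obtain ⟨hTU, hTq⟩ := Finset.mem_filter.1 hT
      obtain ⟨-, x', y', hxy', -, hx', hy'⟩ := hq T hTU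
      refine ⟨h𝓗 T (Finset.mem_sdiff.1 hTU).1, ?_, ?_, fun v hv w hw hvw =>
        (hadj v w).2 ⟨hmax T hTU v hv w hw hvw, hvw⟩⟩
      all_goals
        rw [hTq, hxy, Sym2.eq_iff] at hxy'
        obtain ⟨rfl, rfl⟩ | ⟨rfl, rfl⟩ := hxy' <;> assumption
    refine h1.trans (Nat.mul_le_mul_left _ (Finset.card_le_card ?_))
    intro e he
    obtain ⟨S, hS, rfl⟩ := Finset.mem_image.1 he
    exact (hq S hS).1
  have htot : 𝓗.card ≤ (M + 1) * G.edgeFinset.card := by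
    rw [← Finset.card_sdiff_add_card_eq_card hsub, add_mul, one_mul, hcardS]
    omega
  calc (𝓗.card : ℝ) ≤ (M + 1) * (G.edgeFinset.card : ℝ) := by exact_mod_cast htot
    _ ≤ _ := by
      gcongr
      refine le_trans (le_of_eq ?_) (hG.card_edgeFinset_le ha hb)
      congr!

end Hypergraph

/-! ### Clique counts and the asymptotic bounds -/

namespace Hypergraph

/-- The bound on the number of vertices of a colouring without monochromatic Berge `K_{a,b}`. -/
lemma choose_le_of_not_isRamsey {a b r M k n : ℕ} (ha : 0 < a) (hb : 0 < b) (hr : 2 ≤ r)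
    (hk : 0 < k) (hn : 0 < n)
    (hM : ∀ G : SimpleGraph (Fin n), BicliqueFree a b G → ∀ x y, x ≠ y →
      ∀ 𝓠 : Finset (Finset (Fin n)),
      (∀ S ∈ 𝓠, S.card = r ∧ x ∈ S ∧ y ∈ S ∧ ∀ v ∈ S, ∀ w ∈ S, v ≠ w → G.Adj v w) → 𝓠.card ≤ M)
    (hR : ¬ IsRamsey r (bergeFamily (completeBipartiteGraph (Fin a) (Fin b))) k n) :
    (n.choose r : ℝ) ≤ k * ((M + 1) * ((a + b) * (n : ℝ) ^ (2 - 1 / (b : ℝ)))) := by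
  classical
  have : Nonempty (Fin n) := ⟨⟨0, hn⟩⟩
  have h : ¬ ∀ c : Finset (Fin n) → Fin k, ∃ i,
      HasBergeBiclique a b {e | e.card = r ∧ c e = i} :=
    fun h => hR (isRamsey_of_hasBergeBiclique hk h)
  push Not at h
  obtain ⟨c, hc⟩ := h
  have hcl : ∀ i : Fin k, (((Finset.powersetCard r Finset.univ).filter fun e => c e = i).card : ℝ)
      ≤ (M + 1) * ((a + b) * (n : ℝ) ^ (2 - 1 / (b : ℝ))) := by
    intro i
    have h1 := card_le_of_not_hasBergeBiclique ha hb hr hM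
      ((Finset.powersetCard r Finset.univ).filter fun e => c e = i)
      (fun S hS => (Finset.mem_powersetCard.1 (Finset.mem_filter.1 hS).1).2) (by
        convert hc i using 2
        ext e
        simp)
    rwa [Fintype.card_fin] at h1
  have hsum : n.choose r =
      ∑ i : Fin k, ((Finset.powersetCard r Finset.univ).filter fun e => c e = i).card := by
    rw [← Finset.card_eq_sum_card_fiberwise (fun _ _ => Finset.mem_univ _),
      Finset.card_powersetCard, Finset.card_univ, Fintype.card_fin]
  rw [hsum, Nat.cast_sum]
  refine (Finset.sum_le_sum fun i _ => hcl i).trans ?_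
  rw [Finset.sum_const, Finset.card_univ, Fintype.card_fin, nsmul_eq_mul]

section CliqueBounds

variable {V : Type*} {r : ℕ} {G : SimpleGraph V} {x y : V}

lemma erase_erase_injOn [DecidableEq V] {𝓠 : Finset (Finset V)} (hQ : ∀ S ∈ 𝓠, x ∈ S ∧ y ∈ S) (hxy : x ≠ y) :
    Set.InjOn (fun S : Finset V => (S.erase x).erase y) 𝓠 := by
  intro S hS T hT hST
  have h : ∀ S ∈ 𝓠, insert x (insert y ((S.erase x).erase y)) = S := fun S hS => by
    rw [Finset.insert_erase (Finset.mem_erase.2 ⟨hxy.symm, (hQ S hS).2⟩),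
      Finset.insert_erase (hQ S hS).1]
  rw [← h S hS, ← h T hT]
  simp only at hST
  rw [hST]

lemma card_le_card_pow_of_mem [Fintype V] [DecidableEq V] (hxy : x ≠ y) (𝓠 : Finset (Finset V))
    (hQ : ∀ S ∈ 𝓠, S.card = r ∧ x ∈ S ∧ y ∈ S) : 𝓠.card ≤ Fintype.card V ^ (r - 2) := by
  calc 𝓠.card ≤ (Finset.powersetCard (r - 2) (Finset.univ : Finset V)).card := by
        refine Finset.card_le_card_of_injOn _ ?_ (erase_erase_injOn (fun S hS => (hQ S hS).2) hxy)
        intro S hS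
        obtain ⟨h1, h2, h3⟩ := hQ S hS
        rw [Finset.mem_coe, Finset.mem_powersetCard]
        refine ⟨Finset.subset_univ _, ?_⟩
        rw [Finset.card_erase_of_mem (Finset.mem_erase.2 ⟨hxy.symm, h3⟩),
          Finset.card_erase_of_mem h2, h1]
        omega
    _ = (Fintype.card V).choose (r - 2) := by rw [Finset.card_powersetCard, Finset.card_univ]
    _ ≤ _ := Nat.choose_le_pow _ _

/-- The rest of a clique through `x` and `y` lies in their common neighbourhood, which has fewer
than `a` vertices when `b = 2`. -/
lemma card_cliques_le_two_pow [Fintype V] [DecidableEq V] {a : ℕ} (hG : BicliqueFree a 2 G) (hxy : x ≠ y)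
    (𝓠 : Finset (Finset V))
    (hQ : ∀ S ∈ 𝓠, S.card = r ∧ x ∈ S ∧ y ∈ S ∧ ∀ v ∈ S, ∀ w ∈ S, v ≠ w → G.Adj v w) :
    𝓠.card ≤ 2 ^ a := by
  classical
  have hw : Function.Injective ![x, y] := by
    intro i j hij
    fin_cases i <;> fin_cases j <;> simp_all
  have hc := hG.card_common_lt ![x, y] hw
  calc 𝓠.card ≤ (Finset.univ.filter fun v => ∀ j, G.Adj v (![x, y] j)).powerset.card := by
        refine Finset.card_le_card_of_injOn _ ?_
          (erase_erase_injOn (fun S hS => ⟨(hQ S hS).2.1, (hQ S hS).2.2.1⟩) hxy)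
        intro S hS
        obtain ⟨h1, h2, h3, h4⟩ := hQ S hS
        rw [Finset.mem_coe, Finset.mem_powerset]
        intro v hv
        obtain ⟨hvy, hv⟩ := Finset.mem_erase.1 hv
        obtain ⟨hvx, hv⟩ := Finset.mem_erase.1 hv
        rw [Finset.mem_filter]
        refine ⟨Finset.mem_univ _, fun j => ?_⟩
        fin_cases j
        · exact h4 v hv x h2 hvx
        · exact h4 v hv y h3 hvy
    _ = 2 ^ _ := Finset.card_powerset _
    _ ≤ 2 ^ a := Nat.pow_le_pow_right (by norm_num) hc.le

lemma not_clique_of_bicliqueFree {a b : ℕ} (hG : BicliqueFree a b G) (S : Finset V)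
    (hS : a + b ≤ S.card) : ¬ ∀ v ∈ S, ∀ w ∈ S, v ≠ w → G.Adj v w := by
  intro h
  obtain ⟨T, hTS, hT⟩ := Finset.exists_subset_card_eq hS
  let e : Fin a ⊕ Fin b → V := fun i => ((T.equivFinOfCardEq hT).symm (finSumFinEquiv i) : V)
  have he : Function.Injective e :=
    Subtype.val_injective.comp ((Equiv.injective _).comp (Equiv.injective _))
  have hmem : ∀ i, e i ∈ S := fun i => hTS (Subtype.property _)
  exact hG (fun i => e (Sum.inl i)) (fun j => e (Sum.inr j)) (he.comp Sum.inl_injective)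
    (he.comp Sum.inr_injective) fun i j => h _ (hmem _) _ (hmem _) (he.ne Sum.inl_ne_inr)

end CliqueBounds

lemma pow_le_mul_choose {n r : ℕ} (h : 2 * r ≤ n) :
    (n : ℝ) ^ r ≤ (2 ^ r * r ! : ℝ) * n.choose r := by
  have h1 : ((n + 1 - r : ℕ) ^ r : ℝ) / r ! ≤ n.choose r := Nat.pow_le_choose r n
  have h2 : (n : ℝ) ≤ 2 * (n + 1 - r : ℕ) := by
    have : n ≤ 2 * (n + 1 - r) := by omega
    exact_mod_cast this
  rw [div_le_iff₀ (by positivity)] at h1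
  calc (n : ℝ) ^ r ≤ (2 * (n + 1 - r : ℕ)) ^ r := by gcongr
    _ = 2 ^ r * ((n + 1 - r : ℕ) : ℝ) ^ r := mul_pow _ _ _
    _ ≤ 2 ^ r * (n.choose r * r !) := by gcongr
    _ = _ := by ring

lemma rpow_le_of_not_isRamsey {a b r M k n : ℕ} (ha : 0 < a) (hb : 0 < b) (hr : 2 ≤ r)
    (hk : 0 < k) (hn : 2 * r ≤ n)
    (hM : ∀ G : SimpleGraph (Fin n), BicliqueFree a b G → ∀ x y, x ≠ y →
      ∀ 𝓠 : Finset (Finset (Fin n)),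
      (∀ S ∈ 𝓠, S.card = r ∧ x ∈ S ∧ y ∈ S ∧ ∀ v ∈ S, ∀ w ∈ S, v ≠ w → G.Adj v w) → 𝓠.card ≤ M)
    (hR : ¬ IsRamsey r (bergeFamily (completeBipartiteGraph (Fin a) (Fin b))) k n) :
    (n : ℝ) ^ ((r : ℝ) - 2 + 1 / (b : ℝ)) ≤ (2 ^ r * r ! * (a + b) : ℝ) * (M + 1) * k := by
  have hn0 : (0 : ℝ) < n := by exact_mod_cast (by omega : 0 < n)
  have h1 := pow_le_mul_choose hn
  have h2 := choose_le_of_not_isRamsey ha hb hr hk (by omega) hM hR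
  have h3 : (n : ℝ) ^ r = (n : ℝ) ^ ((r : ℝ) - 2 + 1 / (b : ℝ)) * (n : ℝ) ^ (2 - 1 / (b : ℝ)) := by
    rw [← Real.rpow_add hn0, ← Real.rpow_natCast]
    congr 1
    ring
  refine le_of_mul_le_mul_right ?_ (Real.rpow_pos_of_pos hn0 (2 - 1 / (b : ℝ)))
  rw [← h3]
  calc (n : ℝ) ^ r ≤ (2 ^ r * r ! : ℝ) * n.choose r := h1
    _ ≤ (2 ^ r * r ! : ℝ) * (k * ((M + 1) * ((a + b) * (n : ℝ) ^ (2 - 1 / (b : ℝ))))) := by gcongr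
    _ = _ := by ring

/-- The Ramsey number is finite. -/
lemma exists_isRamsey {a b r k : ℕ} (ha : 0 < a) (hb : 0 < b) (hr : 2 ≤ r) (hk : 0 < k) :
    ∃ n, IsRamsey r (bergeFamily (completeBipartiteGraph (Fin a) (Fin b))) k n := by
  have hb0 : (0 : ℝ) < b := by exact_mod_cast hb
  set K : ℝ := (2 ^ r * r ! * (a + b) : ℝ) * 2 * k with hK
  have htend : Tendsto (fun n : ℕ => (n : ℝ) ^ (1 / (b : ℝ))) atTop atTop :=
    (tendsto_rpow_atTop (by positivity)).comp tendsto_natCast_atTop_atTop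
  obtain ⟨n, hnK, hn⟩ := ((htend.eventually_gt_atTop K).and (eventually_ge_atTop (2 * r))).exists
  refine ⟨n, ?_⟩
  by_contra hR
  have hn0 : (0 : ℝ) < n := by exact_mod_cast (by omega : 0 < n)
  have hn1 : (1 : ℝ) ≤ n := by exact_mod_cast (by omega : 1 ≤ n)
  -- Even the trivial clique count leaves a factor `n ^ (1 / b)`, unbounded for fixed `k`.
  -- Finiteness matters because `sInf ∅ = 0` would void the lower bound.
  have h := rpow_le_of_not_isRamsey (M := n ^ (r - 2)) ha hb hr hk hn
    (fun G _ x y hxy 𝓠 hQ => by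
      have := card_le_card_pow_of_mem (r := r) hxy 𝓠
        fun S hS => ⟨(hQ S hS).1, (hQ S hS).2.1, (hQ S hS).2.2.1⟩
      rwa [Fintype.card_fin] at this) hR
  have hpow : (n : ℝ) ^ ((r : ℝ) - 2 + 1 / (b : ℝ)) =
      (n : ℝ) ^ (r - 2) * (n : ℝ) ^ (1 / (b : ℝ)) := by
    rw [Real.rpow_add hn0, ← Real.rpow_natCast, Nat.cast_sub hr, Nat.cast_ofNat]
  have h1 : (1 : ℝ) ≤ (n : ℝ) ^ (r - 2) := one_le_pow₀ hn1
  rw [hpow] at h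
  have h2 : (n : ℝ) ^ (r - 2) * (n : ℝ) ^ (1 / (b : ℝ)) ≤ (n : ℝ) ^ (r - 2) * K := by
    calc _ ≤ _ := h
      _ = (2 ^ r * r ! * (a + b) : ℝ) * k * ((n : ℝ) ^ (r - 2) + 1) := by push_cast; ring
      _ ≤ (2 ^ r * r ! * (a + b) : ℝ) * k * ((n : ℝ) ^ (r - 2) + (n : ℝ) ^ (r - 2)) := by gcongr
      _ = _ := by rw [hK]; ring
  exact absurd (le_of_mul_le_mul_left h2 (by positivity)) (not_le.2 hnK)

/-- The lower bound for the Ramsey number. -/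
theorem isBigO_bergeBicliqueRamsey {a b r : ℕ} (hb : 2 ≤ b) (ha : (b - 1)! < a)
    (hr₂ : 2 ≤ r) (hr : r < 2 * (a + b) - 1) :
    (fun k : ℕ => (k : ℝ) ^ ((b : ℝ) / (((r : ℝ) - 2) * (b : ℝ) + 1)))
      =O[atTop] fun k : ℕ => (bergeBicliqueRamsey r a b k : ℝ) := by
  obtain ⟨C, hC, hnot⟩ := exists_not_isRamsey hb ha hr₂ hr
  set β : ℝ := (b : ℝ) / (((r : ℝ) - 2) * (b : ℝ) + 1) with hβ
  set D : ℕ := 2 * (2 ^ b) ^ (r - 2) with hD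
  have hr2' : (0 : ℝ) ≤ (r : ℝ) - 2 := by
    have : (2 : ℝ) ≤ r := by exact_mod_cast hr₂
    linarith
  have hden : (0 : ℝ) < ((r : ℝ) - 2) * (b : ℝ) + 1 := by positivity
  have hβ0 : 0 ≤ β := by positivity
  have hD2 : 2 ≤ D := by
    rw [hD]
    exact Nat.le_mul_of_pos_right _ (by positivity)
  -- One more level multiplies the colours by `D` and the vertices by `2 ^ b`; this identity gives
  -- the exponent.
  have hDβ : (D : ℝ) ^ β = (2 ^ b : ℝ) := by
    have h1 : (D : ℝ) = (2 : ℝ) ^ (((r : ℝ) - 2) * (b : ℝ) + 1) := by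
      rw [hD]
      push_cast
      rw [← pow_mul, ← pow_succ', ← Real.rpow_natCast]
      congr 1
      push_cast [Nat.cast_sub hr₂]
      ring
    rw [h1, ← Real.rpow_mul (by norm_num), hβ, mul_div_cancel₀ _ hden.ne', Real.rpow_natCast]
  refine IsBigO.of_bound ((C * D : ℝ) ^ β) ?_
  filter_upwards [eventually_ge_atTop C] with k hk
  have hk0 : 0 < k := hC.trans_le hk
  have hkC : k / C ≠ 0 := (Nat.div_pos hk hC).ne'
  set L := Nat.log D (k / C) with hL
  have h1 : C * D ^ L ≤ k := by
    have := Nat.pow_log_le_self D hkC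
    calc C * D ^ L ≤ C * (k / C) := Nat.mul_le_mul_left _ this
      _ ≤ k := Nat.mul_div_le _ _
  have h2 : k < C * D * D ^ L := by
    have := Nat.lt_pow_succ_log_self (by omega : 1 < D) (k / C)
    rw [Nat.div_lt_iff_lt_mul hC] at this
    calc k < D ^ (L + 1) * C := this
      _ = _ := by ring
  have hlt : (2 ^ b) ^ L ≤ bergeBicliqueRamsey r a b k := by
    by_contra! hlt
    have ha0 : 0 < a := by omega
    exact hnot L k _ hlt.le h1 (Nat.sInf_mem (exists_isRamsey ha0 (by omega) hr₂ hk0))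
  rw [Real.norm_of_nonneg (by positivity), Real.norm_of_nonneg (by positivity)]
  calc (k : ℝ) ^ β ≤ (C * D * D ^ L : ℝ) ^ β := by
        refine Real.rpow_le_rpow (by positivity) ?_ hβ0
        exact_mod_cast h2.le
    _ = (C * D : ℝ) ^ β * ((2 ^ b : ℝ)) ^ L := by
        rw [Real.mul_rpow (by positivity) (by positivity), ← hDβ, Real.rpow_pow_comm (by positivity)]
    _ ≤ (C * D : ℝ) ^ β * bergeBicliqueRamsey r a b k := by
        gcongr
        exact_mod_cast hlt

/-- The upper bound for the Ramsey number, when cliques are rare in graphs without `K_{a,b}`. -/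
theorem bergeBicliqueRamsey_isBigO {a b r : ℕ} (ha : 0 < a) (hb : 0 < b) (hr : 2 ≤ r) (M : ℕ)
    (hM : ∀ (n : ℕ) (G : SimpleGraph (Fin n)), BicliqueFree a b G → ∀ x y, x ≠ y →
      ∀ 𝓠 : Finset (Finset (Fin n)),
      (∀ S ∈ 𝓠, S.card = r ∧ x ∈ S ∧ y ∈ S ∧ ∀ v ∈ S, ∀ w ∈ S, v ≠ w → G.Adj v w) →
        𝓠.card ≤ M) :
    (fun k : ℕ => (bergeBicliqueRamsey r a b k : ℝ))
      =O[atTop] fun k : ℕ => (k : ℝ) ^ ((b : ℝ) / (((r : ℝ) - 2) * (b : ℝ) + 1)) := by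
  set β : ℝ := (b : ℝ) / (((r : ℝ) - 2) * (b : ℝ) + 1) with hβ
  have hb0 : (0 : ℝ) < b := by exact_mod_cast hb
  have hr2' : (0 : ℝ) ≤ (r : ℝ) - 2 := by
    have : (2 : ℝ) ≤ r := by exact_mod_cast hr
    linarith
  have hden : (0 : ℝ) < ((r : ℝ) - 2) * (b : ℝ) + 1 := by positivity
  have hβ0 : 0 ≤ β := by positivity
  have hinv : ((r : ℝ) - 2 + 1 / (b : ℝ)) * β = 1 := by
    rw [hβ]
    field_simp
  set K : ℝ := (2 ^ r * r ! * (a + b) : ℝ) * (M + 1) with hK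
  -- The part `2 * r` covers small Ramsey numbers, where the binomial estimate is unavailable; the
  -- factor `2` pays for passing from `n = R - 1` to `R`.
  refine IsBigO.of_bound (2 * r + 1 + 2 * K ^ β) ?_
  filter_upwards [eventually_ge_atTop 1] with k hk
  rw [Real.norm_of_nonneg (by positivity), Real.norm_of_nonneg (by positivity)]
  have hk1 : (1 : ℝ) ≤ (k : ℝ) ^ β := Real.one_le_rpow (by exact_mod_cast hk) hβ0
  set R := bergeBicliqueRamsey r a b k with hR
  obtain hsmall | hbig := le_or_gt R (2 * r)
  · calc (R : ℝ) ≤ 2 * r * 1 := by rw [mul_one]; exact_mod_cast hsmall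
      _ ≤ (2 * r + 1 + 2 * K ^ β) * (k : ℝ) ^ β := by
        gcongr
        have : 0 ≤ K ^ β := by positivity
        linarith
  · obtain ⟨n, hn⟩ : ∃ n, R = n + 1 := ⟨R - 1, by omega⟩
    have hnR : ¬ IsRamsey r (bergeFamily (completeBipartiteGraph (Fin a) (Fin b))) k n := by
      refine Nat.notMem_of_lt_sInf (s := {n | IsRamsey r _ k n}) ?_
      change n < R
      omega
    have h := rpow_le_of_not_isRamsey ha hb hr hk (by omega) (hM n) hnR
    have hn1 : (1 : ℝ) ≤ n := by exact_mod_cast (by omega : 1 ≤ n)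
    have h2 : (n : ℝ) ≤ K ^ β * (k : ℝ) ^ β := by
      calc (n : ℝ) = ((n : ℝ) ^ ((r : ℝ) - 2 + 1 / (b : ℝ))) ^ β := by
            rw [← Real.rpow_mul (by positivity), hinv, Real.rpow_one]
        _ ≤ (K * k) ^ β := Real.rpow_le_rpow (by positivity) h hβ0
        _ = _ := Real.mul_rpow (by positivity) (by positivity)
    calc (R : ℝ) = n + 1 := by rw [hn]; push_cast; ring
      _ ≤ 2 * (K ^ β * (k : ℝ) ^ β) := by linarith
      _ = 2 * K ^ β * (k : ℝ) ^ β := by ring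
      _ ≤ (2 * r + 1 + 2 * K ^ β) * (k : ℝ) ^ β := by
        gcongr
        have : (0 : ℝ) ≤ r := by positivity
        linarith

end Hypergraph

theorem theorem3 (a b r : ℕ) (hb : 2 ≤ b) (ha : (b - 1)! < a)
    (hr₂ : 2 ≤ r) (hr : r < 2 * (a + b) - 1) :
    ((fun k : ℕ => (k : ℝ) ^ ((b : ℝ) / (((r : ℝ) - 2) * (b : ℝ) + 1)))
        =O[atTop] fun k : ℕ => (Hypergraph.bergeBicliqueRamsey r a b k : ℝ)) ∧
    ((b = 2 ∨ a + b ≤ r) →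
      (fun k : ℕ => (Hypergraph.bergeBicliqueRamsey r a b k : ℝ))
        =Θ[atTop] fun k : ℕ => (k : ℝ) ^ ((b : ℝ) / (((r : ℝ) - 2) * (b : ℝ) + 1))) := by
  have hlow := Hypergraph.isBigO_bergeBicliqueRamsey hb ha hr₂ hr
  refine ⟨hlow, fun h => ⟨?_, hlow⟩⟩
  have ha0 : 0 < a := by omega
  obtain rfl | hab := h
  · exact Hypergraph.bergeBicliqueRamsey_isBigO ha0 (by omega) hr₂ (2 ^ a)
      fun n G hG x y hxy 𝓠 hQ => Hypergraph.card_cliques_le_two_pow hG hxy 𝓠 hQ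
  · refine Hypergraph.bergeBicliqueRamsey_isBigO ha0 (by omega) hr₂ 0
      fun n G hG x y _ 𝓠 hQ => ?_
    rw [Nat.le_zero, Finset.card_eq_zero]
    refine Finset.eq_empty_of_forall_notMem fun S hS => ?_
    obtain ⟨h1, -, -, h2⟩ := hQ S hS
    exact Hypergraph.not_clique_of_bicliqueFree hG S (by omega) h2
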